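/- **Setting.** Write $\mathbb R_+=[0,\infty)$ and $(f*L)(t)=\int_{[0,t]}f(t-s)\,L(ds)$. Let $\rho\in[-1,1]$, $\eta\ge 0$, $\lambda\ge 0$, and $$\mathcal R(w,\varphi)=\tfrac12(w^2-w)+\Big(\rho\eta w-\lambda+\tfrac{\eta^2}{2}\varphi\Big)\varphi ,\qquad w,\varphi\in\mathbb C .$$ A kernel $K$ is said to satisfy *condition (2)* if it is not identically zero, non-negative, non-increasing and continuous on $(0,\infty)$, and admits a resolvent of the first kind $L$ (a measure on $\mathbb R_+$ of locally bounded variation with $K*L=1$ on $(0,\infty)$) which is non-negative and such that $s\mapsto L([s,s+t])$ is non-increasing on $\mathbb R_+$ for every $t>0$. The class $\mathcal K$ consists of the real-valued $K\in L^2_{loc}(\mathbb R_+)$ that satisfy condition (2) and for which there are $\gamma\in(0,2]$ and a locally bounded $c_K:\mathbb R_+\to\mathbb R_+$ with $$\int_0^{\xi}|K(t)|^2dt+\int_0^{T-\xi}|K(t+\xi)-K(t)|^2dt\le c_K(T)\,\xi^{\gamma}\qquad (0<\xi\le T).$$ For $K\in\mathcal K$ with constant $\gamma$ and resolvent $L$,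 and with $\Delta_\xi f=f(\cdot+\xi)$, let $\mathcal G_K$ be the set of all $g:\mathbb R_+\to\mathbb R$ that are Hölder continuous on compact sets of every order less than $\gamma/2$, with $g(0)\ge 0$ and $$\Delta_\xi g-(\Delta_\xi K*L)(0)\,g-d(\Delta_\xi K*L)*g\ \ge 0\quad\text{on }\mathbb R_+,\ \text{for all }\xi\ge 0$$ (for $\xi=0$ this reads $0\ge 0$, since $K*L=1$). Here $d(\Delta_\xi K*L)$ is the Lebesgue–Stieltjes measure of the function $\Delta_\xi K*L$, without atom at $0$. Let $\mathcal G_K^*$ be the set of bounded measurable $h:\mathbb R_+\to\mathbb C$ with compact support such that $t\mapsto-\operatorname{Re}\int_0^\infty h(\xi)K(t+\xi)\,d\xi$ belongs to $\mathcal G_K$. **Proposition.** Let $K\in\mathcal K$ be such that $\Delta_\xi K$ satisfies condition (2) for every $\xi\ge 0$. Let $w\in\mathbb C$ with $\operatorname{Re}(w)\in[0,1]$ and $h\in\mathcal G_K^*$. Then there is a function $\Psi:\mathbb R_+\times\mathbb R_+\to\mathbb C$ that solves the Riccati equation $$\Psi(t,\xi)=h(\xi-t)\,\mathbf 1_{\{\xi\ge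 t\}}+\mathcal R\Big(w,\int_0^\infty\Psi(t-\xi,z)K(z)\,dz\Big)\mathbf 1_{\{\xi<t\}}\qquad\text{for all }t,\xi\ge 0,$$ and satisfies $\Psi(t,\cdot)\in\mathcal G_K^*$ for all $t\ge 0$. -/

import Mathlib

open MeasureTheory Set
open scoped NNReal ENNReal

namespace VolterraHeston

/-! Functions on `ℝ₊ = [0, ∞)` are represented by functions on `ℝ` of which only the values on
`[0, ∞)` are used. For a kernel `K`, only the values on `(0, ∞)` are used: `K` may be singular at
`0`, and its value there is irrelevant. -/

/-- `K ∈ L²_loc(ℝ₊)`: square integrable on `(0, T]` for every `T > 0`. -/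
def LocallySquareIntegrable (K : ℝ → ℝ) : Prop :=
  ∀ T : ℝ, 0 < T → MemLp K 2 (volume.restrict (Ioc 0 T))

/-- The shift operator `Δ_ξ f = f(· + ξ)`. -/
def shift (ξ : ℝ) (f : ℝ → ℝ) : ℝ → ℝ := fun t => f (t + ξ)

/-- The convolution `(f * L)(t) = ∫_{[0,t]} f(t - s) L(ds)` of a function with a measure. -/
noncomputable def conv (f : ℝ → ℝ) (L : Measure ℝ) (t : ℝ) : ℝ :=
  ∫ s in Icc 0 t, f (t - s) ∂L

/-- There is a locally bounded `c : ℝ₊ → ℝ₊` with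
`∫₀^ξ |K(t)|² dt + ∫₀^{T-ξ} |K(t+ξ) - K(t)|² dt ≤ c(T) ξ^γ` for all `0 < ξ ≤ T`. -/
def ModulusCondition (K : ℝ → ℝ) (γ : ℝ) : Prop :=
  ∃ c : ℝ → ℝ, (∀ T, 0 ≤ T → 0 ≤ c T) ∧ (∀ T, ∃ C, ∀ s ∈ Icc 0 T, c s ≤ C) ∧
    ∀ T ξ : ℝ, 0 < ξ → ξ ≤ T →
      (∫ t in (0 : ℝ)..ξ, |K t| ^ 2) + (∫ t in (0 : ℝ)..(T - ξ), |K (t + ξ) - K t| ^ 2)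
        ≤ c T * ξ ^ γ

/-- `L` is a non-negative, locally finite Borel measure on `ℝ₊` which is a resolvent of the first
kind of `K`, that is, `K * L = 1`. The identity is required on `(0, ∞)`, since the value of `K` at
`0` carries no information. -/
structure IsFirstKindResolvent (K : ℝ → ℝ) (L : Measure ℝ) : Prop where
  support : L (Iio 0) = 0
  locallyFinite : ∀ T : ℝ, L (Icc 0 T) < ∞
  conv_eq_one : ∀ t : ℝ, 0 < t → conv K L t = 1

/-- `K` is not identically zero, non-negative, non-increasing and continuous on `(0, ∞)`, and `L` is
a non-negative resolvent of the first kind of `K` such that `s ↦ L([s, s + t])` is non-increasing on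
`ℝ₊` for every `t > 0`. -/
structure MonotoneCondition (K : ℝ → ℝ) (L : Measure ℝ) : Prop where
  ne_zero : ∃ t : ℝ, 0 < t ∧ K t ≠ 0
  nonneg : ∀ t : ℝ, 0 < t → 0 ≤ K t
  antitone : AntitoneOn K (Ioi 0)
  continuous : ContinuousOn K (Ioi 0)
  resolvent : IsFirstKindResolvent K L
  resolvent_antitone : ∀ t : ℝ, 0 < t → AntitoneOn (fun s => L (Icc s (s + t))) (Ici 0)

/-- `K` belongs to the class `𝒦`, with regularity constant `γ` and resolvent of the first
kind `L`. -/
structure IsAdmissibleKernel (K : ℝ → ℝ) (γ : ℝ) (L : Measure ℝ) : Prop where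
  sq_integrable : LocallySquareIntegrable K
  gamma_mem : γ ∈ Ioc (0 : ℝ) 2
  modulus : ModulusCondition K γ
  monotone : MonotoneCondition K L

/-- A resolvent as in `MonotoneCondition` has no atoms in `(0, ∞)`. -/
theorem MonotoneCondition.measure_singleton {K : ℝ → ℝ} {L : Measure ℝ}
    (hK : MonotoneCondition K L) {t : ℝ} (ht : 0 < t) : L {t} = 0 := by
  by_contra hne
  have hpos : 0 < L {t} := pos_iff_ne_zero.mpr hne
  have key : ∀ s ∈ Ioc 0 t, L {t} ≤ L {s} := by
    intro s hs
    have hlim : L {s} = ⨅ n : ℕ, L (Icc s (s + 1 / ((n : ℝ) + 1))) := by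
      have hset : ({s} : Set ℝ) = ⋂ n : ℕ, Icc s (s + 1 / ((n : ℝ) + 1)) := by
        ext x
        simp only [mem_singleton_iff, mem_iInter, mem_Icc]
        refine ⟨fun hx n => ⟨hx.ge, by rw [hx]; have := @Nat.one_div_pos_of_nat ℝ _ _ _ n; linarith⟩,
          fun hx => le_antisymm ?_ (hx 0).1⟩
        by_contra hlt
        obtain ⟨n, hn⟩ := exists_nat_one_div_lt (sub_pos.mpr (not_le.mp hlt))
        have := (hx n).2
        linarith
      rw [hset]
      refine Antitone.measure_iInter ?_ (fun n => measurableSet_Icc.nullMeasurableSet) ⟨0, ?_⟩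
      · intro m n hmn
        refine Icc_subset_Icc le_rfl ?_
        have := Nat.one_div_le_one_div (α := ℝ) hmn
        linarith
      · refine ((measure_mono (Icc_subset_Icc hs.1.le le_rfl)).trans_lt
          (hK.resolvent.locallyFinite _)).ne
    rw [hlim]
    refine le_iInf fun n => ?_
    have hn := @Nat.one_div_pos_of_nat ℝ _ _ _ n
    refine le_trans (measure_mono ?_) (hK.resolvent_antitone _ hn hs.1.le ht.le hs.2)
    simp only [singleton_subset_iff, mem_Icc]
    constructor <;> linarith
  have hcount := Measure.countable_meas_pos_of_disjoint_of_meas_iUnion_ne_top (ι := Ioc 0 t) L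
    (As := fun i => {(i : ℝ)}) (fun i => measurableSet_singleton _)
    (fun i j hij => by simpa [Function.onFun] using fun hc => hij (Subtype.ext hc))
    (((measure_mono (t := Icc 0 t) (iUnion_subset fun i => by
      simpa using ⟨i.2.1.le, i.2.2⟩)).trans_lt (hK.resolvent.locallyFinite t)).ne)
  have huniv : {i : Ioc 0 t | 0 < L {(i : ℝ)}} = univ :=
    eq_univ_of_forall fun i => hpos.trans_le (key i i.2)
  rw [huniv, countable_univ_iff] at hcount
  have h0 : volume (Ioc 0 t) = 0 := (countable_coe_iff.mp hcount).measure_zero _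
  rw [Real.volume_Ioc] at h0
  simp at h0
  linarith

/-- Translating an open interval to the right does not increase its mass. -/
theorem MonotoneCondition.measure_Ioo_le {K : ℝ → ℝ} {L : Measure ℝ}
    (hK : MonotoneCondition K L) {a b δ : ℝ} (ha : 0 ≤ a) (hδ : 0 ≤ δ) :
    L (Ioo (a + δ) (b + δ)) ≤ L (Ioo a b) := by
  have hset : Ioo (a + δ) (b + δ) = ⋃ n : ℕ, Ioo (a + δ + 1 / ((n : ℝ) + 1)) (b + δ) := by
    ext x
    simp only [mem_iUnion, mem_Ioo]
    constructor
    · rintro ⟨h1, h2⟩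
      obtain ⟨n, hn⟩ := exists_nat_one_div_lt (sub_pos.mpr h1)
      exact ⟨n, by linarith, h2⟩
    · rintro ⟨n, h1, h2⟩
      have := @Nat.one_div_pos_of_nat ℝ _ _ _ n
      exact ⟨by linarith, h2⟩
  have hmono : Monotone fun n : ℕ => Ioo (a + δ + 1 / ((n : ℝ) + 1)) (b + δ) := by
    intro m n hmn
    refine Ioo_subset_Ioo ?_ le_rfl
    have := Nat.one_div_le_one_div (α := ℝ) hmn
    linarith
  rw [hset, hmono.measure_iUnion]
  refine iSup_le fun n => ?_
  have hn := @Nat.one_div_pos_of_nat ℝ _ _ _ n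
  set e : ℝ := 1 / ((n : ℝ) + 1)
  rcases le_or_gt b (a + e) with hab | hab
  · rw [Ioo_eq_empty (by linarith)]
    simp
  · have hanti := hK.resolvent_antitone (b - (a + e)) (by linarith)
      (show a + e ∈ Ici (0 : ℝ) from by simp only [mem_Ici]; linarith)
      (show a + e + δ ∈ Ici (0 : ℝ) from by simp only [mem_Ici]; linarith)
      (by linarith : a + e ≤ a + e + δ)
    simp only at hanti
    calc L (Ioo (a + δ + e) (b + δ))
        ≤ L (Icc (a + e + δ) (a + e + δ + (b - (a + e)))) := by
          refine measure_mono fun x hx => ⟨?_, ?_⟩ <;> [linarith [hx.1]; linarith [hx.2]]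
      _ ≤ L (Icc (a + e) (a + e + (b - (a + e)))) := hanti
      _ ≤ L (Ioo a b ∪ {b}) := by
          refine measure_mono fun x hx => ?_
          rcases hx with ⟨h1, h2⟩
          rcases eq_or_lt_of_le (show x ≤ b by linarith) with h | h
          · exact Or.inr h
          · exact Or.inl ⟨by linarith, h⟩
      _ ≤ L (Ioo a b) + L {b} := measure_union_le _ _
      _ = L (Ioo a b) := by rw [hK.measure_singleton (by linarith), add_zero]

/-- The functions `Δ_ξ K * L` are non-decreasing on `ℝ₊`. -/
theorem monotone_conv_shift {K : ℝ → ℝ} {L : Measure ℝ} (hK : MonotoneCondition K L) {ξ : ℝ}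
    (hξ : 0 < ξ) : Monotone (fun t => conv (shift ξ K) L (max t 0)) := by
  -- the mass of `K(t + ξ - ·)` on `(t, t + ξ)`
  set H : ℝ → ℝ≥0∞ := fun t => ∫⁻ s in Ioo t (t + ξ), ENNReal.ofReal (K (t + ξ - s)) ∂L with hH
  have hmeas : ∀ t, AEMeasurable (fun s => K (t + ξ - s)) (L.restrict (Ioo t (t + ξ))) := by
    intro t
    refine ContinuousOn.aemeasurable ?_ measurableSet_Ioo
    refine hK.continuous.comp (by fun_prop) fun s hs => ?_
    simp only [mem_Ioi]
    linarith [hs.2]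
  have hnn : ∀ t, 0 ≤ᵐ[L.restrict (Ioo t (t + ξ))] fun s => K (t + ξ - s) := by
    intro t
    filter_upwards [ae_restrict_mem measurableSet_Ioo] with s hs
    exact hK.nonneg _ (by linarith [hs.2])
  have hHanti : ∀ t u : ℝ, 0 ≤ t → t ≤ u → H u ≤ H t := by
    intro t u ht htu
    simp only [hH]
    rw [lintegral_eq_lintegral_meas_lt _ (hnn u) (hmeas u),
      lintegral_eq_lintegral_meas_lt _ (hnn t) (hmeas t)]
    refine lintegral_mono fun x => ?_
    simp only
    set S : Set ℝ := {v | v ∈ Ioo 0 ξ ∧ x < K v} with hS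
    have hrep : ∀ r : ℝ, L.restrict (Ioo r (r + ξ)) {s | x < K (r + ξ - s)}
        = L {s | r + ξ - s ∈ S} := by
      intro r
      rw [Measure.restrict_apply' measurableSet_Ioo]
      congr 1
      ext s
      simp only [hS, mem_inter_iff, mem_ofPred_eq, mem_Ioo]
      constructor
      · rintro ⟨h1, h2, h3⟩
        exact ⟨⟨by linarith, by linarith⟩, h1⟩
      · rintro ⟨⟨h2, h3⟩, h1⟩
        exact ⟨h1, by linarith, by linarith⟩
    rw [hrep u, hrep t]
    rcases S.eq_empty_or_nonempty with hemp | ⟨v₀, hv₀⟩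
    · simp [hemp]
    have hbdd : BddAbove S := ⟨ξ, fun v hv => hv.1.2.le⟩
    have hSeq : S = Ioo 0 (sSup S) := by
      ext v
      constructor
      · intro hv
        refine ⟨hv.1.1, ?_⟩
        have hopen : IsOpen S := by
          have h1 : IsOpen (Ioi (0 : ℝ) ∩ K ⁻¹' Ioi x) :=
            hK.continuous.isOpen_inter_preimage isOpen_Ioi isOpen_Ioi
          have h2 : S = (Ioi (0 : ℝ) ∩ K ⁻¹' Ioi x) ∩ Iio ξ := by
            ext v
            simp only [hS, mem_ofPred_eq, mem_Ioo, mem_inter_iff, mem_Ioi, mem_preimage, mem_Iio]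
            tauto
          rw [h2]
          exact h1.inter isOpen_Iio
        obtain ⟨ε, hε, hball⟩ := Metric.isOpen_iff.mp hopen v hv
        have : v + ε / 2 ∈ S := hball (by
          rw [Metric.mem_ball, Real.dist_eq, add_sub_cancel_left, abs_of_pos (by linarith)]
          linarith)
        have := le_csSup hbdd this
        linarith
      · rintro ⟨h0, h1⟩
        obtain ⟨y, hy, hvy⟩ := exists_lt_of_lt_csSup ⟨v₀, hv₀⟩ h1
        exact ⟨⟨h0, hvy.trans hy.1.2⟩,
          hy.2.trans_le (hK.antitone (mem_Ioi.mpr h0) (mem_Ioi.mpr hy.1.1) hvy.le)⟩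
    have hle : sSup S ≤ ξ := csSup_le ⟨v₀, hv₀⟩ fun v hv => hv.1.2.le
    have hpre : ∀ r : ℝ, {s | r + ξ - s ∈ S} = Ioo (r + ξ - sSup S) (r + ξ) := by
      intro r
      rw [hSeq]
      ext s
      have : sSup (Ioo 0 (sSup S)) = sSup S := by rw [← hSeq]
      simp only [mem_ofPred_eq, mem_Ioo, this]
      constructor <;> rintro ⟨h1, h2⟩ <;> constructor <;> linarith
    rw [hpre u, hpre t]
    have := hK.measure_Ioo_le (a := t + ξ - sSup S) (b := t + ξ) (δ := u - t) (by linarith)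
      (by linarith)
    convert this using 3 <;> ring
  have hF : ∀ t : ℝ, 0 ≤ t → conv (shift ξ K) L t = 1 - (H t).toReal ∧ H t ≠ ∞ := by
    intro t ht
    have h1 : ∫ s in Icc 0 (t + ξ), K (t + ξ - s) ∂L = 1 :=
      hK.resolvent.conv_eq_one (t + ξ) (by linarith)
    have hint : IntegrableOn (fun s => K (t + ξ - s)) (Icc 0 (t + ξ)) L := by
      by_contra hc
      rw [integral_undef hc] at h1
      exact zero_ne_one h1
    have hsplit : Icc 0 (t + ξ) = Icc 0 t ∪ Ioc t (t + ξ) :=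
      (Icc_union_Ioc_eq_Icc ht (by linarith)).symm
    have hdisj : Disjoint (Icc 0 t) (Ioc t (t + ξ)) :=
      disjoint_left.mpr fun x hx hx' => not_lt.mpr hx.2 hx'.1
    rw [hsplit] at hint h1
    rw [setIntegral_union hdisj measurableSet_Ioc hint.left_of_union hint.right_of_union] at h1
    have hae : Ioo t (t + ξ) =ᵐ[L] Ioc t (t + ξ) := by
      rw [← Ioo_union_right (by linarith : t < t + ξ)]
      exact (union_ae_eq_left_of_ae_eq_empty
        (ae_eq_empty.mpr (hK.measure_singleton (by linarith)))).symm
    rw [← setIntegral_congr_set hae] at h1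
    have hi2 : IntegrableOn (fun s => K (t + ξ - s)) (Ioo t (t + ξ)) L :=
      hint.right_of_union.mono_set Ioo_subset_Ioc_self
    rw [integral_eq_lintegral_of_nonneg_ae (hnn t) hi2.aestronglyMeasurable] at h1
    refine ⟨?_, ?_⟩
    · have : conv (shift ξ K) L t = ∫ s in Icc 0 t, K (t + ξ - s) ∂L := by
        simp only [conv, shift]
        congr 1
        ext s
        congr 1
        ring
      rw [this]
      linarith
    · exact ((hasFiniteIntegral_iff_ofReal (hnn t)).mp hi2.2).ne
  intro t u htu
  have ht := hF (max t 0) (le_max_right _ _)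
  have hu := hF (max u 0) (le_max_right _ _)
  simp only
  rw [ht.1, hu.1]
  have := ENNReal.toReal_mono ht.2
    (hHanti (max t 0) (max u 0) (le_max_right _ _) (max_le_max htu le_rfl))
  linarith

open Classical in
/-- The Lebesgue-Stieltjes measure `dF` on `ℝ₊` of a non-decreasing function `F` on `ℝ₊`, that is,
`dF((a, b]) = F(b) - F(a)` for right-continuous `F` and `0 ≤ a ≤ b`. Since `F` is extended by `F(0)`
to the left of `0`, there is no atom at `0` when `F` is right-continuous there. (The value for a
function that is not non-decreasing is a default one; the functions `Δ_ξ K * L` to which this is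
applied are non-decreasing, see `monotone_conv_shift`.) -/
noncomputable def stieltjesMeasure (F : ℝ → ℝ) : Measure ℝ :=
  if hF : Monotone (fun t => F (max t 0)) then hF.stieltjesFunction.measure else 0

/-- `g ∈ H^β`: Hölder continuous on compact subsets of `ℝ₊`, of any order less than `β`. -/
def MemHolderBelow (β : ℝ) (g : ℝ → ℝ) : Prop :=
  ∀ r : ℝ≥0, (r : ℝ) < β → ∀ T : ℝ, ∃ C : ℝ≥0, HolderOnWith C r g (Icc 0 T)

/-- The set `𝒢_K` of all `g ∈ H^{γ/2}` with `g(0) ≥ 0` and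
`Δ_ξ g - (Δ_ξ K * L)(0) g - d(Δ_ξ K * L) * g ≥ 0` on `ℝ₊` for all `ξ`. For `ξ = 0` the last
condition reads `0 ≥ 0`, because `K * L = 1`; so it is only imposed for `ξ > 0`, where the value of
`K` at `0` plays no role. -/
def GSet (γ : ℝ) (K : ℝ → ℝ) (L : Measure ℝ) : Set (ℝ → ℝ) :=
  {g | MemHolderBelow (γ / 2) g ∧ 0 ≤ g 0 ∧
    ∀ ξ : ℝ, 0 < ξ → ∀ t : ℝ, 0 ≤ t →
      0 ≤ shift ξ g t - conv (shift ξ K) L 0 * g t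
        - conv g (stieltjesMeasure (conv (shift ξ K) L)) t}

/-- Bounded Borel functions `ℝ₊ → ℂ` with compact support. -/
def IsBoundedCompactlySupported (h : ℝ → ℂ) : Prop :=
  Measurable (fun x : ℝ≥0 => h x) ∧ (∃ C : ℝ, ∀ x, 0 ≤ x → ‖h x‖ ≤ C) ∧
    ∃ M : ℝ, ∀ x, 0 ≤ x → M < x → h x = 0

/-- The dual set `𝒢*_K` of all bounded compactly supported `h : ℝ₊ → ℂ` such that
`t ↦ -Re ∫₀^∞ h(ξ) K(t + ξ) dξ` belongs to `𝒢_K`. -/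
def GStarSet (γ : ℝ) (K : ℝ → ℝ) (L : Measure ℝ) : Set (ℝ → ℂ) :=
  {h | IsBoundedCompactlySupported h ∧
    (fun t : ℝ => -(∫ ξ in Ioi (0 : ℝ), h ξ * (K (t + ξ) : ℂ)).re) ∈ GSet γ K L}

/-- `ℛ(w, φ) = (w² - w)/2 + (ρ η w - λ + (η²/2) φ) φ`, where `lam` stands for `λ`. -/
noncomputable def riccatiOp (ρ η lam : ℝ) (w φ : ℂ) : ℂ :=
  (w ^ 2 - w) / 2 + ((ρ : ℂ) * η * w - lam + (η : ℂ) ^ 2 / 2 * φ) * φ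

/-- `Ψ` is a (global) solution of the Riccati equation
`Ψ(t, ξ) = h(ξ - t) 1_{ξ ≥ t} + ℛ(w, ∫₀^∞ Ψ(t - ξ, z) K(z) dz) 1_{ξ < t}`, `t, ξ ≥ 0`. -/
def IsRiccatiSolution (ρ η lam : ℝ) (K : ℝ → ℝ) (w : ℂ) (h : ℝ → ℂ) (Ψ : ℝ → ℝ → ℂ) : Prop :=
  ∀ t ξ : ℝ, 0 ≤ t → 0 ≤ ξ →
    Ψ t ξ = if t ≤ ξ then h (ξ - t)
      else riccatiOp ρ η lam w (∫ z in Ioi (0 : ℝ), Ψ (t - ξ) z * (K z : ℂ))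

end VolterraHeston

/-! Write `g` for the forward curve `t ↦ ∫ h(ξ) K(t + ξ) dξ`. If `Ψ` solves the Riccati equation,
then `ψ(t) = ∫ Ψ(t, z) K(z) dz` solves the Volterra equation `ψ = g + K * ℛ(w, ψ)`. Conversely, a
global solution `ψ` yields `Ψ`: splice `h(ξ - t)` for `ξ ≥ t` with `ℛ(w, ψ(t - ξ))` for `ξ < t`. It
remains to solve the scalar equation globally with `Re ψ ≤ 0`, and to check that the spliced
functions stay in `𝒢*_K`.

Both rest on the identity `Δ_δ K = F(0) K + dF * K` with `F = Δ_δ K * L`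
(`MonotoneCondition.kernelMeasure_shift_eq`). For `X = G + K * Z` it expresses `X(r + δ)` through
the contribution of `Z` on `[r, r + δ]`, a non-negative combination of the values of `X` on `[0,
r]`, and the quantity that is non-negative when `G` satisfies the inequalities of `𝒢_K`
(`IsForwardPositive.le_add_conv`). So `X` cannot cross zero if `Z ≥ 0` where `X` is small, and a
perturbation argument relaxes this to `Z ≥ -c |X|` (`IsForwardPositive.nonneg`).

For existence, `ℛ` is composed with a projection onto a rectangle of size `N`, which makes it
Lipschitz. The positivity principle, applied to `-Re ψ`, gives `Re ψ ≤ 0`, because `|ρ| ≤ 1` and `Re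
w ∈ [0, 1]`. Applied to `u ± Im ψ`, with `u` a solution of a linear Volterra equation, it bounds `Im
ψ`. In `-Re ℛ` the term `-η²/2 (Re ψ)²` then has a favourable sign, so Gronwall bounds `-Re ψ`.
These bounds do not depend on `N`, so a large `N` makes the projection inactive on `[0, T]`
(`IsAdmissibleKernel.exists_riccati_on`), and uniqueness glues the solutions over all `T`.

Finally, `s ↦ -Re` of the forward curve of `Ψ(t, ·)` is `X(t + s)`, where `X = G + K * Z` and `Z` is
switched off after time `t`. With no contribution of `Z` beyond `t`, the identity and `X ≥ 0` give
the inequalities of `𝒢_K` (`IsForwardPositive.shift_add_conv`). -/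

namespace VolterraHeston

open Filter Topology

/-! ### Volterra equations driven by a measure: continuity, Gronwall, existence. -/

section Volterra

variable {E : Type*} [NormedAddCommGroup E] [NormedSpace ℝ E]

/-- The convolution `t ↦ ∫_{[0,t]} f(t - s) κ(ds)` of a vector-valued function with a measure. -/
noncomputable def vconv (f : ℝ → E) (κ : Measure ℝ) (t : ℝ) : E :=
  ∫ s in Icc 0 t, f (t - s) ∂κ

theorem vconv_eq_conv (f : ℝ → ℝ) (κ : Measure ℝ) : vconv f κ = conv f κ := rfl

theorem integrableOn_reflect {F : Type*} [NormedAddCommGroup F] {κ : Measure ℝ}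
    [IsLocallyFiniteMeasure κ] {f : ℝ → F} {t : ℝ}
    (hf : ContinuousOn f (Icc 0 t)) : IntegrableOn (fun s => f (t - s)) (Icc 0 t) κ := by
  refine ContinuousOn.integrableOn_compact isCompact_Icc ?_
  refine hf.comp (by fun_prop) fun s hs => ⟨by linarith [hs.2], by linarith [hs.1]⟩

theorem vconv_congr {κ : Measure ℝ} {f g : ℝ → E} {t : ℝ} (h : ∀ s ∈ Icc 0 t, f s = g s) :
    vconv f κ t = vconv g κ t :=
  setIntegral_congr_fun measurableSet_Icc fun s hs =>
    h _ ⟨by linarith [hs.2], by linarith [hs.1]⟩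

theorem vconv_add {κ : Measure ℝ} [IsLocallyFiniteMeasure κ] {f g : ℝ → E} {t : ℝ}
    (hf : ContinuousOn f (Icc 0 t)) (hg : ContinuousOn g (Icc 0 t)) :
    vconv (fun s => f s + g s) κ t = vconv f κ t + vconv g κ t :=
  integral_add (integrableOn_reflect hf) (integrableOn_reflect hg)

theorem vconv_sub {κ : Measure ℝ} [IsLocallyFiniteMeasure κ] {f g : ℝ → E} {t : ℝ}
    (hf : ContinuousOn f (Icc 0 t)) (hg : ContinuousOn g (Icc 0 t)) :
    vconv (fun s => f s - g s) κ t = vconv f κ t - vconv g κ t :=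
  integral_sub (integrableOn_reflect hf) (integrableOn_reflect hg)

theorem vconv_mono {κ : Measure ℝ} [IsLocallyFiniteMeasure κ] {f g : ℝ → ℝ} {t : ℝ}
    (hf : ContinuousOn f (Icc 0 t)) (hg : ContinuousOn g (Icc 0 t)) (h : ∀ s ∈ Icc 0 t, f s ≤ g s) :
    vconv f κ t ≤ vconv g κ t :=
  setIntegral_mono_on (integrableOn_reflect hf) (integrableOn_reflect hg) measurableSet_Icc
    fun s hs => h _ ⟨by linarith [hs.2], by linarith [hs.1]⟩

theorem vconv_nonneg {κ : Measure ℝ} {f : ℝ → ℝ} {t : ℝ} (h : ∀ s ∈ Icc 0 t, 0 ≤ f s) :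
    0 ≤ vconv f κ t :=
  setIntegral_nonneg measurableSet_Icc
    fun s hs => h _ ⟨by linarith [hs.2], by linarith [hs.1]⟩

theorem norm_vconv_le {κ : Measure ℝ} {f : ℝ → E} {t : ℝ} :
    ‖vconv f κ t‖ ≤ vconv (fun s => ‖f s‖) κ t :=
  norm_integral_le_integral_norm _

/-- Convolutions of continuous functions with measures without atoms in `(0, ∞)` are
continuous. -/
theorem continuousOn_vconv {κ : Measure ℝ} [IsLocallyFiniteMeasure κ]
    (hκ : ∀ t, 0 < t → κ {t} = 0) {f : ℝ → E} (hf : ContinuousOn f (Ici 0)) :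
    ContinuousOn (vconv f κ) (Ici 0) := by
  intro t₀ ht₀
  have ht₀' : (0 : ℝ) ≤ t₀ := ht₀
  set g : ℝ → E := fun x => f (max x 0) with hg
  have hgc : Continuous g := by
    rw [← continuousOn_univ]
    exact hf.comp (by fun_prop) fun x _ => mem_Ici.mpr (le_max_right _ _)
  obtain ⟨C, hC⟩ := (isCompact_Icc (a := (0 : ℝ)) (b := t₀ + 1)).exists_bound_of_continuousOn
    hgc.continuousOn
  have hrep : ∀ t ∈ Icc 0 (t₀ + 1), vconv f κ t
      = ∫ s in Icc 0 (t₀ + 1), (Iic t).indicator (fun s => g (t - s)) s ∂κ := by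
    intro t ht
    rw [setIntegral_indicator measurableSet_Iic]
    have : Icc 0 (t₀ + 1) ∩ Iic t = Icc 0 t := by
      ext s
      simp only [mem_inter_iff, mem_Icc, mem_Iic]
      exact ⟨fun h => ⟨h.1.1, h.2⟩, fun h => ⟨⟨h.1, h.2.trans ht.2⟩, h.2⟩⟩
    rw [this]
    refine setIntegral_congr_fun measurableSet_Icc fun s hs => ?_
    simp only [hg]
    rw [max_eq_left (by linarith [hs.2])]
  have hev : ∀ᶠ t in 𝓝[Ici 0] t₀, t ∈ Icc 0 (t₀ + 1) := by
    filter_upwards [self_mem_nhdsWithin,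
      mem_nhdsWithin_of_mem_nhds (Iio_mem_nhds (by linarith : t₀ < t₀ + 1))] with t h1 h2
    exact ⟨h1, le_of_lt h2⟩
  have hcongr : vconv f κ =ᶠ[𝓝[Ici 0] t₀]
      fun t => ∫ s in Icc 0 (t₀ + 1), (Iic t).indicator (fun s => g (t - s)) s ∂κ :=
    hev.mono fun t ht => hrep t ht
  refine ContinuousWithinAt.congr_of_eventuallyEq ?_ hcongr (hrep t₀ ⟨ht₀, by linarith⟩)
  refine tendsto_integral_filter_of_dominated_convergence (fun _ => C) ?_ ?_ ?_ ?_
  · refine Eventually.of_forall fun t => ?_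
    exact ((hgc.comp (by fun_prop)).aestronglyMeasurable).indicator measurableSet_Iic
  · filter_upwards [hev] with t ht
    filter_upwards [ae_restrict_mem measurableSet_Icc] with s hs
    by_cases h : s ∈ Iic t
    · rw [indicator_of_mem h]
      exact hC _ ⟨by linarith [mem_Iic.mp h], by linarith [hs.1, ht.2]⟩
    · rw [indicator_of_notMem h, norm_zero]
      exact (norm_nonneg _).trans (hC 0 ⟨le_rfl, by linarith⟩)
  · exact integrableOn_const (measure_Icc_lt_top).ne
  -- The integrand can jump at `t₀` only for `s = t₀`, a null point when `t₀ > 0`. For `t₀ = 0` an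
  -- atom at `0` is harmless: `t` approaches from the right, so the indicator is constantly one
  -- there.
  · have hae : ∀ᵐ s ∂(κ.restrict (Icc 0 (t₀ + 1))), s ≠ t₀ ∨ (s = t₀ ∧ t₀ = 0) := by
      rcases eq_or_lt_of_le ht₀' with h | h
      · exact Eventually.of_forall fun s => by
          by_cases hs : s = t₀
          · exact Or.inr ⟨hs, h.symm⟩
          · exact Or.inl hs
      · refine ae_restrict_of_ae ?_
        have : κ {t₀} = 0 := hκ _ h
        filter_upwards [measure_eq_zero_iff_ae_notMem.mp this] with s hs
        exact Or.inl hs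
    filter_upwards [hae] with s hs
    have hcont : Tendsto (fun t => g (t - s)) (𝓝[Ici 0] t₀) (𝓝 (g (t₀ - s))) :=
      ((hgc.comp (continuous_id.sub continuous_const)).tendsto t₀).mono_left nhdsWithin_le_nhds
    rcases hs with hs | ⟨hs, h0⟩
    · rcases lt_or_gt_of_ne hs with h | h
      · rw [indicator_of_mem (show s ∈ Iic t₀ from h.le)]
        refine hcont.congr' ?_
        filter_upwards [mem_nhdsWithin_of_mem_nhds (Ioi_mem_nhds h)] with t ht
        rw [indicator_of_mem (mem_Iic.mpr (le_of_lt (mem_Ioi.mp ht)))]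
      · rw [indicator_of_notMem (show s ∉ Iic t₀ from not_le.mpr h)]
        refine tendsto_const_nhds.congr' ?_
        filter_upwards [mem_nhdsWithin_of_mem_nhds (Iio_mem_nhds h)] with t ht
        rw [indicator_of_notMem (fun hc => not_le.mpr (mem_Iio.mp ht) (mem_Iic.mp hc))]
    · rw [indicator_of_mem (show s ∈ Iic t₀ from hs.le)]
      refine hcont.congr' ?_
      filter_upwards [self_mem_nhdsWithin] with t ht
      rw [indicator_of_mem (show s ∈ Iic t by rw [hs, h0]; exact ht)]

/-- An exponential weight makes the mass of `κ` on `[0, T]` arbitrarily small. -/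
theorem exists_exp_weight {κ : Measure ℝ} [IsLocallyFiniteMeasure κ] [NullSingletonClass κ]
    (T ℓ : ℝ) :
    ∃ β : ℝ, 0 ≤ β ∧ ℓ * ∫ s in Icc 0 T, Real.exp (-(β * s)) ∂κ ≤ 1 / 2 := by
  have hlim : Tendsto (fun n : ℕ => ∫ s in Icc 0 T, Real.exp (-((n : ℝ) * s)) ∂κ) atTop
      (𝓝 (∫ s in Icc 0 T, (0 : ℝ) ∂κ)) := by
    refine tendsto_integral_of_dominated_convergence (fun _ => 1) ?_ ?_ ?_ ?_
    · intro n
      exact (Continuous.aestronglyMeasurable (by fun_prop))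
    · exact integrableOn_const (measure_Icc_lt_top).ne
    · intro n
      filter_upwards [ae_restrict_mem measurableSet_Icc] with s hs
      rw [Real.norm_eq_abs, abs_of_pos (Real.exp_pos _), Real.exp_le_one_iff]
      have := mul_nonneg (Nat.cast_nonneg (α := ℝ) n) hs.1
      linarith
    · have h0 : ∀ᵐ s ∂(κ.restrict (Icc 0 T)), s ∉ ({0} : Set ℝ) :=
        ae_restrict_of_ae (measure_eq_zero_iff_ae_notMem.mp (measure_singleton (μ := κ) (0 : ℝ)))
      filter_upwards [ae_restrict_mem measurableSet_Icc, h0] with s hs hs0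
      have hs0 : 0 < s := lt_of_le_of_ne hs.1 (Ne.symm hs0)
      refine Real.tendsto_exp_neg_atTop_nhds_zero.comp ?_
      exact tendsto_natCast_atTop_atTop.atTop_mul_const hs0
  have hlim' := hlim.const_mul ℓ
  simp only [integral_zero, mul_zero] at hlim'
  obtain ⟨n, hn⟩ := (hlim'.eventually (ge_mem_nhds (by norm_num : (0 : ℝ) < 1 / 2))).exists
  exact ⟨n, Nat.cast_nonneg n, hn⟩

/-- A Gronwall inequality for convolutions. -/
theorem exists_volterra_gronwall (κ : Measure ℝ) [IsLocallyFiniteMeasure κ] [NullSingletonClass κ]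
    (T : ℝ) {ℓ : ℝ} (hℓ : 0 ≤ ℓ) :
    ∃ C : ℝ, 0 ≤ C ∧ ∀ (f : ℝ → ℝ) (a : ℝ), 0 ≤ a → ContinuousOn f (Icc 0 T) →
      (∀ t ∈ Icc 0 T, f t ≤ a + ℓ * vconv f κ t) → ∀ t ∈ Icc 0 T, f t ≤ C * a := by
  obtain ⟨β, hβ, hβℓ⟩ := exists_exp_weight (κ := κ) T ℓ
  refine ⟨2 * Real.exp (β * T), by positivity, fun f a ha hf hle t ht => ?_⟩
  have hne : (Icc 0 T).Nonempty := ⟨t, ht⟩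
  -- At a maximum point of the weighted function, the choice of `β` turns the hypothesis into `m ≤ a
  -- + m / 2` whenever `m > 0`.
  obtain ⟨r, hr, hmax⟩ := isCompact_Icc.exists_isMaxOn hne
    (f := fun s => Real.exp (-(β * s)) * f s) (ContinuousOn.mul (by fun_prop) hf)
  set m := Real.exp (-(β * r)) * f r with hm
  have hmle : m ≤ 2 * a := by
    rcases le_or_gt m 0 with h | h
    · linarith
    have h1 : vconv f κ r ≤ Real.exp (β * r) * m * ∫ s in Icc 0 T, Real.exp (-(β * s)) ∂κ := by
      have hfr : ContinuousOn f (Icc 0 r) := hf.mono (Icc_subset_Icc le_rfl hr.2)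
      have hI : IntegrableOn (fun s => Real.exp (-(β * s))) (Icc 0 T) κ :=
        ContinuousOn.integrableOn_compact isCompact_Icc (by fun_prop)
      calc vconv f κ r ≤ ∫ s in Icc 0 r, Real.exp (β * r) * m * Real.exp (-(β * s)) ∂κ := by
            refine setIntegral_mono_on (integrableOn_reflect hfr)
              ((hI.mono_set (Icc_subset_Icc le_rfl hr.2)).const_mul _) measurableSet_Icc
              fun s hs => ?_
            have h2 : Real.exp (-(β * (r - s))) * f (r - s) ≤ m :=
              hmax (show r - s ∈ Icc 0 T from ⟨by linarith [hs.2], by linarith [hs.1, hr.2]⟩)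
            calc f (r - s) = Real.exp (β * (r - s)) * (Real.exp (-(β * (r - s))) * f (r - s)) := by
                  rw [← mul_assoc, ← Real.exp_add, add_neg_cancel, Real.exp_zero, one_mul]
              _ ≤ Real.exp (β * (r - s)) * m := by gcongr
              _ = Real.exp (β * r) * m * Real.exp (-(β * s)) := by
                  rw [mul_right_comm, ← Real.exp_add]
                  congr 2
                  ring
        _ = Real.exp (β * r) * m * ∫ s in Icc 0 r, Real.exp (-(β * s)) ∂κ :=
            integral_const_mul _ _
        _ ≤ _ := by
            refine mul_le_mul_of_nonneg_left ?_ (by positivity)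
            exact setIntegral_mono_set hI (Eventually.of_forall fun s => (Real.exp_pos _).le)
              (Icc_subset_Icc le_rfl hr.2).eventuallyLE
    have h3 := hle r hr
    have h4 : m ≤ Real.exp (-(β * r)) * (a + ℓ * (Real.exp (β * r) * m
        * ∫ s in Icc 0 T, Real.exp (-(β * s)) ∂κ)) := by
      rw [hm]
      refine mul_le_mul_of_nonneg_left (h3.trans ?_) (Real.exp_pos _).le
      gcongr
    have h5 : Real.exp (-(β * r)) * (a + ℓ * (Real.exp (β * r) * m
        * ∫ s in Icc 0 T, Real.exp (-(β * s)) ∂κ))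
        = Real.exp (-(β * r)) * a + m * (ℓ * ∫ s in Icc 0 T, Real.exp (-(β * s)) ∂κ) := by
      have : Real.exp (-(β * r)) * Real.exp (β * r) = 1 := by
        rw [← Real.exp_add, neg_add_cancel, Real.exp_zero]
      linear_combination (ℓ * m * ∫ s in Icc 0 T, Real.exp (-(β * s)) ∂κ) * this
    have h6 : Real.exp (-(β * r)) * a ≤ a := by
      refine mul_le_of_le_one_left ha ?_
      rw [Real.exp_le_one_iff]
      have := mul_nonneg hβ hr.1
      linarith
    have h7 : m * (ℓ * ∫ s in Icc 0 T, Real.exp (-(β * s)) ∂κ) ≤ m * (1 / 2) := by gcongr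
    linarith
  have h8 : Real.exp (-(β * t)) * f t ≤ m := hmax ht
  calc f t = Real.exp (β * t) * (Real.exp (-(β * t)) * f t) := by
        rw [← mul_assoc, ← Real.exp_add, add_neg_cancel, Real.exp_zero, one_mul]
    _ ≤ Real.exp (β * t) * (2 * a) := mul_le_mul_of_nonneg_left (h8.trans hmle) (Real.exp_pos _).le
    _ ≤ Real.exp (β * T) * (2 * a) := by
        have := ht.2
        gcongr
    _ = _ := by ring

/-- Banach's fixed point theorem in the sup norm on `C([0, T], E)`: the smallness assumption gives
contraction factor `1/2`. The general case reduces to this one by an exponential weight. -/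
theorem exists_volterra_solution_of_small [CompleteSpace E] (κ : Measure ℝ)
    [IsLocallyFiniteMeasure κ] [NullSingletonClass κ] {T : ℝ} (hT : 0 ≤ T) {ℓ : ℝ} (hℓ : 0 ≤ ℓ)
    (hsmall : ℓ * (κ (Icc 0 T)).toReal ≤ 1 / 2) {g : ℝ → E} (hg : ContinuousOn g (Icc 0 T))
    {B : ℝ → E → E} (hB : Continuous fun p : ℝ × E => B p.1 p.2)
    (hlip : ∀ t ∈ Icc 0 T, ∀ x y, ‖B t x - B t y‖ ≤ ℓ * ‖x - y‖) :
    ∃ X : ℝ → E, Continuous X ∧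
      ∀ t ∈ Icc 0 T, X t = g t + vconv (fun s => B s (X s)) κ t := by
  have hc : ∀ φ : C(Icc (0 : ℝ) T, E), Continuous fun s => B s (IccExtend hT φ s) := fun φ =>
    hB.comp (continuous_id.prodMk (φ.continuous.Icc_extend'))
  let Φ : C(Icc (0 : ℝ) T, E) → C(Icc (0 : ℝ) T, E) := fun φ =>
    ⟨fun t => g t + vconv (fun s => B s (IccExtend hT φ s)) κ t, by
      refine Continuous.add (continuousOn_iff_continuous_domRestrict.mp hg) ?_
      exact continuousOn_iff_continuous_domRestrict.mp <|
        (continuousOn_vconv (fun t _ => measure_singleton t) (hc φ).continuousOn).mono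
        fun t ht => ht.1⟩
  have hΦ : ContractingWith (1 / 2) Φ := by
    refine ⟨by norm_num, LipschitzWith.of_dist_le_mul fun φ χ => ?_⟩
    rw [ContinuousMap.dist_le (by positivity)]
    intro t
    have hnn := measureReal_nonneg (μ := κ) (s := Icc (0 : ℝ) t)
    have h1 : dist (Φ φ t) (Φ χ t) = ‖vconv (fun s => B s (IccExtend hT φ s)
        - B s (IccExtend hT χ s)) κ t‖ := by
      rw [vconv_sub (hc φ).continuousOn (hc χ).continuousOn, dist_eq_norm]
      congr 1
      exact add_sub_add_left_eq_sub _ _ _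
    rw [h1]
    have h2 : ‖vconv (fun s => B s (IccExtend hT φ s) - B s (IccExtend hT χ s)) κ t‖
        ≤ (ℓ * dist φ χ) * (κ (Icc 0 (t : ℝ))).toReal := by
      refine norm_setIntegral_le_of_norm_le_const measure_Icc_lt_top fun s hs => ?_
      have hmem : (t : ℝ) - s ∈ Icc 0 T := ⟨by linarith [hs.2], by linarith [hs.1, t.2.2]⟩
      refine (hlip _ hmem _ _).trans ?_
      refine mul_le_mul_of_nonneg_left ?_ hℓ
      rw [← dist_eq_norm]
      exact ContinuousMap.dist_apply_le_dist _
    refine h2.trans ?_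
    have h3 : (κ (Icc 0 (t : ℝ))).toReal ≤ (κ (Icc 0 T)).toReal :=
      ENNReal.toReal_mono measure_Icc_lt_top.ne (measure_mono (Icc_subset_Icc le_rfl t.2.2))
    calc ℓ * dist φ χ * (κ (Icc 0 (t : ℝ))).toReal ≤ ℓ * dist φ χ * (κ (Icc 0 T)).toReal := by
          gcongr
      _ = (ℓ * (κ (Icc 0 T)).toReal) * dist φ χ := by ring
      _ ≤ 1 / 2 * dist φ χ := by gcongr
      _ = _ := by norm_num
  have : Nonempty (Icc (0 : ℝ) T) := ⟨⟨0, le_rfl, hT⟩⟩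
  let φ := hΦ.fixedPoint Φ
  have hφ : Φ φ = φ := hΦ.fixedPoint_isFixedPt
  refine ⟨IccExtend hT φ, φ.continuous.Icc_extend', fun t ht => ?_⟩
  rw [IccExtend_of_mem hT φ ht]
  conv_lhs => rw [← hφ]
  rfl

/-- Volterra equations with Lipschitz coefficients are solvable. -/
theorem exists_volterra_solution [CompleteSpace E] (κ : Measure ℝ) [IsLocallyFiniteMeasure κ]
    [NullSingletonClass κ] {T : ℝ} (hT : 0 ≤ T) {ℓ : ℝ} (hℓ : 0 ≤ ℓ) {g : ℝ → E}
    (hg : ContinuousOn g (Icc 0 T)) {B : ℝ → E → E} (hB : Continuous fun p : ℝ × E => B p.1 p.2)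
    (hlip : ∀ t ∈ Icc 0 T, ∀ x y, ‖B t x - B t y‖ ≤ ℓ * ‖x - y‖) :
    ∃ X : ℝ → E, Continuous X ∧
      ∀ t ∈ Icc 0 T, X t = g t + vconv (fun s => B s (X s)) κ t := by
  obtain ⟨β, hβ, hβℓ⟩ := exists_exp_weight (κ := κ) T ℓ
  -- The weighted unknown `Y(t) = exp(-βt) X(t)` solves an equation with the same Lipschitz
  -- constant, driven by `exp(-βs) κ(ds)`, whose mass on `[0, T]` is small.
  set d : ℝ → ℝ≥0 := fun s => Real.toNNReal (Real.exp (-(β * s))) with hd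
  have hdc : Continuous d := by fun_prop
  set κ' : Measure ℝ := κ.withDensity fun s => (d s : ℝ≥0∞) with hκ'
  have : IsLocallyFiniteMeasure κ' := IsLocallyFiniteMeasure.withDensity_coe hdc
  have : NullSingletonClass κ' :=
    ⟨fun x => withDensity_absolutelyContinuous _ _ (measure_singleton x)⟩
  have hdval : ∀ s, (d s : ℝ) = Real.exp (-(β * s)) := fun s =>
    Real.coe_toNNReal _ (Real.exp_pos _).le
  have hint : ∀ (t : ℝ) (f : ℝ → E), ∫ s in Icc 0 t, f s ∂κ'
      = ∫ s in Icc 0 t, Real.exp (-(β * s)) • f s ∂κ := by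
    intro t f
    rw [hκ', setIntegral_withDensity_eq_setIntegral_smul hdc.measurable _ measurableSet_Icc]
    refine setIntegral_congr_fun measurableSet_Icc fun s _ => ?_
    change (d s : ℝ) • f s = _
    rw [hdval]
  have hmass : (κ' (Icc 0 T)).toReal = ∫ s in Icc 0 T, Real.exp (-(β * s)) ∂κ := by
    rw [hκ', withDensity_apply _ measurableSet_Icc, integral_eq_lintegral_of_nonneg_ae
      (Eventually.of_forall fun s => (Real.exp_pos _).le)
      (Continuous.aestronglyMeasurable (by fun_prop))]
    rfl
  obtain ⟨Y, hYc, hY⟩ := exists_volterra_solution_of_small κ' hT hℓ (by rw [hmass]; exact hβℓ)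
    (g := fun t => Real.exp (-(β * t)) • g t) (ContinuousOn.smul (by fun_prop) hg)
    (B := fun t x => Real.exp (-(β * t)) • B t (Real.exp (β * t) • x))
    (Continuous.smul (by fun_prop) (hB.comp (continuous_fst.prodMk
      (Continuous.smul (by fun_prop) continuous_snd))))
    (by
      intro t ht x y
      rw [← smul_sub, norm_smul, Real.norm_eq_abs, abs_of_pos (Real.exp_pos _)]
      calc Real.exp (-(β * t)) * ‖B t (Real.exp (β * t) • x) - B t (Real.exp (β * t) • y)‖
          ≤ Real.exp (-(β * t)) * (ℓ * ‖Real.exp (β * t) • x - Real.exp (β * t) • y‖) := by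
            gcongr; exact hlip t ht _ _
        _ = (Real.exp (-(β * t)) * Real.exp (β * t)) * (ℓ * ‖x - y‖) := by
            rw [← smul_sub, norm_smul, Real.norm_eq_abs, abs_of_pos (Real.exp_pos _)]
            ring
        _ = ℓ * ‖x - y‖ := by rw [← Real.exp_add, neg_add_cancel, Real.exp_zero, one_mul])
  refine ⟨fun t => Real.exp (β * t) • Y t, Continuous.smul (by fun_prop) hYc, fun t ht => ?_⟩
  simp only
  rw [hY t ht, smul_add, smul_smul, ← Real.exp_add, add_neg_cancel, Real.exp_zero, one_smul]
  congr 1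
  simp only [vconv]
  rw [hint, ← integral_smul]
  refine setIntegral_congr_fun measurableSet_Icc fun s _ => ?_
  simp only [smul_smul]
  rw [← Real.exp_add, ← Real.exp_add]
  have : β * t + (-(β * s) + -(β * (t - s))) = 0 := by ring
  rw [← add_assoc] at this
  rw [← add_assoc, this, Real.exp_zero, one_smul]

end Volterra

/-! ### The kernel as a measure on the half-line. -/

/-- The density `K 1_{(0, ∞)}` of the measure `K(x) dx` on `(0, ∞)`. -/
noncomputable def kernelDensity (K : ℝ → ℝ) : ℝ → ℝ≥0∞ :=
  (Ioi 0).indicator fun s => ENNReal.ofReal (K s)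

/-- The measure `K(x) dx` on `(0, ∞)`. -/
noncomputable def kernelMeasure (K : ℝ → ℝ) : Measure ℝ :=
  volume.withDensity (kernelDensity K)

/-- Kernels which are continuous and non-negative on `(0, ∞)` and locally integrable on
`[0, ∞)`. -/
structure IsRegularKernel (K : ℝ → ℝ) : Prop where
  continuousOn : ContinuousOn K (Ioi 0)
  nonneg : ∀ t, 0 < t → 0 ≤ K t
  integrableOn : ∀ T, IntegrableOn K (Ioc 0 T)

theorem IsAdmissibleKernel.isRegularKernel {K : ℝ → ℝ} {γ : ℝ} {L : Measure ℝ}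
    (hK : IsAdmissibleKernel K γ L) : IsRegularKernel K := by
  refine ⟨hK.monotone.continuous, hK.monotone.nonneg, fun T => ?_⟩
  rcases le_or_gt T 0 with h | h
  · simp [Ioc_eq_empty (not_lt.mpr h)]
  · exact (hK.sq_integrable T h).integrable (by norm_num)

theorem IsRegularKernel.shift_kernel {K : ℝ → ℝ} (hK : IsRegularKernel K) {δ : ℝ} (hδ : 0 < δ) :
    IsRegularKernel (shift δ K) := by
  have hc : ContinuousOn (shift δ K) (Ici 0) :=
    hK.continuousOn.comp (by fun_prop) fun x hx => by
      simp only [mem_Ici, mem_Ioi] at *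
      linarith
  refine ⟨hc.mono Ioi_subset_Ici_self, fun t ht => hK.nonneg _ (by linarith), fun T => ?_⟩
  exact ((hc.mono Icc_subset_Ici_self).integrableOn_compact isCompact_Icc).mono_set
    Ioc_subset_Icc_self

theorem IsRegularKernel.measurable_kernelDensity {K : ℝ → ℝ} (hK : IsRegularKernel K) :
    Measurable (kernelDensity K) := by
  classical
  rw [kernelDensity, ← piecewise_eq_indicator]
  exact ContinuousOn.measurable_piecewise
    (ENNReal.continuous_ofReal.comp_continuousOn hK.continuousOn) continuousOn_const
    measurableSet_Ioi

theorem IsRegularKernel.kernelMeasure_Iic_lt_top {K : ℝ → ℝ} (hK : IsRegularKernel K) (T : ℝ) :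
    kernelMeasure K (Iic T) < ∞ := by
  rw [kernelMeasure, withDensity_apply _ measurableSet_Iic, kernelDensity,
    setLIntegral_indicator measurableSet_Ioi]
  have h : Ioi (0 : ℝ) ∩ Iic T = Ioc 0 T := rfl
  rw [h]
  exact (hK.integrableOn T).lintegral_lt_top

theorem kernelMeasure_Iic_zero (K : ℝ → ℝ) : kernelMeasure K (Iic 0) = 0 := by
  rw [kernelMeasure, withDensity_apply _ measurableSet_Iic, kernelDensity,
    setLIntegral_indicator measurableSet_Ioi]
  have h : Ioi (0 : ℝ) ∩ Iic 0 = ∅ := by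
    ext x
    simp
  simp [h]

theorem IsRegularKernel.isLocallyFiniteMeasure {K : ℝ → ℝ} (hK : IsRegularKernel K) :
    IsLocallyFiniteMeasure (kernelMeasure K) :=
  ⟨fun x => ⟨Iic (x + 1), Iic_mem_nhds (by linarith), hK.kernelMeasure_Iic_lt_top _⟩⟩

instance (K : ℝ → ℝ) : NullSingletonClass (kernelMeasure K) :=
  ⟨fun x => withDensity_absolutelyContinuous _ _ (measure_singleton x)⟩

theorem IsRegularKernel.setIntegral_kernelMeasure {E : Type*} [NormedAddCommGroup E]
    [NormedSpace ℝ E] {K : ℝ → ℝ} (hK : IsRegularKernel K) (f : ℝ → E) {s : Set ℝ}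
    (hs : MeasurableSet s) (hs0 : s ⊆ Ioi 0) :
    ∫ x in s, f x ∂(kernelMeasure K) = ∫ x in s, K x • f x := by
  rw [kernelMeasure, setIntegral_withDensity_eq_setIntegral_toReal_smul
    hK.measurable_kernelDensity]
  · refine setIntegral_congr_fun hs fun x hx => ?_
    simp only [kernelDensity]
    rw [indicator_of_mem (hs0 hx), ENNReal.toReal_ofReal (hK.nonneg _ (hs0 hx))]
  · refine Eventually.of_forall fun x => ?_
    by_cases hx : x ∈ Ioi (0 : ℝ) <;> simp [kernelDensity, hx]
  · exact hs

/-! ### Convolution of measures and cancellation of Lebesgue measure on the half-line. -/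

section MeasureConvolution

open Measure

/-- Tonelli and the translation invariance of Lebesgue measure. -/
theorem withDensity_conv_eq {k : ℝ → ℝ≥0∞} (hk : Measurable k) (L : Measure ℝ) [SFinite L] :
    (volume.withDensity k) ∗ L = volume.withDensity fun t => ∫⁻ s, k (t - s) ∂L := by
  have hm : Measurable fun p : ℝ × ℝ => k (p.1 - p.2) := hk.comp (by fun_prop)
  refine ext_of_lintegral _ fun f hf => ?_
  rw [lintegral_conv hf, lintegral_withDensity_eq_lintegral_mul _ hk
    (Measurable.lintegral_prod_right (by fun_prop)),
    lintegral_withDensity_eq_lintegral_mul _ hm.lintegral_prod_right hf]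
  calc ∫⁻ x, (k * fun x => ∫⁻ y, f (x + y) ∂L) x = ∫⁻ x, ∫⁻ y, k x * f (x + y) ∂L := by
        refine lintegral_congr fun x => ?_
        rw [Pi.mul_apply, lintegral_const_mul _ (by fun_prop)]
    _ = ∫⁻ y, (∫⁻ x, k x * f (x + y)) ∂L := lintegral_lintegral_swap (by fun_prop)
    _ = ∫⁻ y, (∫⁻ t, k (t - y) * f t) ∂L := by
        refine lintegral_congr fun y => ?_
        rw [← lintegral_sub_right_eq_self _ y]
        simp
    _ = ∫⁻ t, ∫⁻ y, k (t - y) * f t ∂L := lintegral_lintegral_swap (by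
        exact ((hm.comp measurable_swap).mul (hf.comp measurable_snd)).aemeasurable)
    _ = _ := by
        refine lintegral_congr fun t => ?_
        have hkt : Measurable fun y => k (t - y) := hk.comp (by fun_prop)
        exact lintegral_mul_const _ hkt

theorem restrict_Ioi_conv_eq (L : Measure ℝ) [SFinite L] :
    (volume.restrict (Ioi 0)) ∗ L = volume.withDensity fun t => L (Iio t) := by
  have h : (volume : Measure ℝ).restrict (Ioi 0) = volume.withDensity ((Ioi 0).indicator 1) := by
    rw [withDensity_indicator_one measurableSet_Ioi]
  rw [h, withDensity_conv_eq (measurable_one.indicator measurableSet_Ioi)]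
  congr 1
  ext t
  have : (fun s => (Ioi (0 : ℝ)).indicator (1 : ℝ → ℝ≥0∞) (t - s)) = (Iio t).indicator 1 := by
    ext s
    simp only [indicator, mem_Ioi, mem_Iio, sub_pos]
    rfl
  rw [this, lintegral_indicator_one measurableSet_Iio]

/-- The map `t ↦ α (Iio t)` is left-continuous, so its value at `t` is a supremum over points to the
left, and between any such point and `t` there is one where the two measures agree. -/
theorem measure_Iio_le_of_ae {α β : Measure ℝ}
    (h : ∀ᵐ t, α (Iio t) = β (Iio t)) (t : ℝ) : α (Iio t) ≤ β (Iio t) := by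
  have hset : Iio t = ⋃ n : ℕ, Iio (t - 1 / ((n : ℝ) + 1)) := by
    ext x
    simp only [mem_Iio, mem_iUnion]
    constructor
    · intro hx
      obtain ⟨n, hn⟩ := exists_nat_one_div_lt (sub_pos.mpr hx)
      exact ⟨n, by linarith⟩
    · rintro ⟨n, hn⟩
      have := @Nat.one_div_pos_of_nat ℝ _ _ _ n
      linarith
  have hmono : Monotone fun n : ℕ => Iio (t - 1 / ((n : ℝ) + 1)) := by
    intro m n hmn
    refine Iio_subset_Iio ?_
    have := Nat.one_div_le_one_div (α := ℝ) hmn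
    linarith
  conv_lhs => rw [hset, hmono.measure_iUnion]
  refine iSup_le fun n => ?_
  have hn := @Nat.one_div_pos_of_nat ℝ _ _ _ n
  obtain ⟨s, hs, hsab⟩ : ∃ s, α (Iio s) = β (Iio s) ∧ s ∈ Ioo (t - 1 / ((n : ℝ) + 1)) t := by
    by_contra hc
    have h0 : volume (Ioo (t - 1 / ((n : ℝ) + 1)) t) = 0 := by
      refine measure_mono_null (fun s hs => ?_) (ae_iff.mp h)
      exact fun hs' => hc ⟨s, hs', hs⟩
    rw [Real.volume_Ioo, ENNReal.ofReal_eq_zero] at h0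
    linarith
  calc α (Iio (t - 1 / ((n : ℝ) + 1))) ≤ α (Iio s) := measure_mono (Iio_subset_Iio hsab.1.le)
    _ = β (Iio s) := hs
    _ ≤ β (Iio t) := measure_mono (Iio_subset_Iio hsab.2.le)

/-- Convolution with Lebesgue measure on `(0, ∞)` is injective. -/
theorem eq_of_conv_restrict_Ioi_eq {α β : Measure ℝ} [SFinite α] [SFinite β]
    (hβ : ∀ t, β (Iio t) < ∞)
    (h : (volume.restrict (Ioi 0)) ∗ α = (volume.restrict (Ioi 0)) ∗ β) : α = β := by
  have hmeas : ∀ μ : Measure ℝ, Measurable fun t => μ (Iio t) := fun μ =>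
    (Monotone.measurable fun s t hst => measure_mono (Iio_subset_Iio hst))
  rw [restrict_Ioi_conv_eq, restrict_Ioi_conv_eq,
    withDensity_eq_iff_of_sigmaFinite (hmeas α).aemeasurable (hmeas β).aemeasurable] at h
  have heq : ∀ t, α (Iio t) = β (Iio t) := fun t =>
    le_antisymm (measure_Iio_le_of_ae h t) (measure_Iio_le_of_ae (h.mono fun _ => Eq.symm) t)
  refine ext_of_generateFrom_of_iUnion (range Iio) (fun n : ℕ => Iio (n : ℝ))
    ((borel_eq_generateFrom_Iio ℝ).symm ▸ BorelSpace.measurable_eq) isPiSystem_Iio ?_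
    (fun n => mem_range_self _) (fun n => by rw [heq]; exact (hβ _).ne) ?_
  · exact eq_univ_of_forall fun x => mem_iUnion.mpr (exists_nat_gt x)
  · rintro _ ⟨t, rfl⟩
    exact heq t

theorem kernelDensity_of_nonpos (K : ℝ → ℝ) {x : ℝ} (hx : x ≤ 0) : kernelDensity K x = 0 :=
  indicator_of_notMem (fun hc => not_lt.mpr hx (mem_Ioi.mp hc)) _

/-- The two integrands can differ at `s = t`, where `conv` uses the irrelevant value `J 0` and
`kernelDensity` is zero; hence the assumption that `t` is not an atom. -/
theorem lintegral_kernelDensity_sub {J : ℝ → ℝ} {L : Measure ℝ} (hJ : ∀ t, 0 < t → 0 ≤ J t)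
    (hL : L (Iio 0) = 0) {t : ℝ} (ht : L {t} = 0)
    (hi : IntegrableOn (fun s => J (t - s)) (Icc 0 t) L) :
    ∫⁻ s, kernelDensity J (t - s) ∂L = ENNReal.ofReal (conv J L t) := by
  have h0 := measure_eq_zero_iff_ae_notMem.mp hL
  have h1 := measure_eq_zero_iff_ae_notMem.mp ht
  rw [conv, ofReal_integral_eq_lintegral_ofReal hi, ← lintegral_indicator measurableSet_Icc]
  · refine lintegral_congr_ae ?_
    filter_upwards [h0, h1] with s hs0 hs1
    have hs0 : 0 ≤ s := not_lt.mp hs0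
    by_cases hst : s < t
    · rw [indicator_of_mem (show s ∈ Icc 0 t from ⟨hs0, hst.le⟩), kernelDensity,
        indicator_of_mem (mem_Ioi.mpr (sub_pos.mpr hst))]
    · have hst' : t < s := lt_of_le_of_ne (not_lt.mp hst) (Ne.symm hs1)
      rw [indicator_of_notMem (fun hc => not_le.mpr hst' hc.2),
        kernelDensity_of_nonpos _ (by linarith)]
  · filter_upwards [ae_restrict_mem measurableSet_Icc, ae_restrict_of_ae h1] with s hs hs1
    exact hJ _ (sub_pos.mpr (lt_of_le_of_ne hs.2 hs1))

theorem lintegral_kernelDensity_sub_of_neg {J : ℝ → ℝ} {L : Measure ℝ}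
    (hL : L (Iio 0) = 0) {t : ℝ} (ht : t < 0) : ∫⁻ s, kernelDensity J (t - s) ∂L = 0 := by
  rw [lintegral_eq_zero_iff' (by
    refine (aemeasurable_const (b := (0 : ℝ≥0∞))).congr ?_
    filter_upwards [measure_eq_zero_iff_ae_notMem.mp hL] with s hs
    rw [kernelDensity_of_nonpos _ (by linarith [not_lt.mp (mt mem_Iio.mpr hs)])])]
  filter_upwards [measure_eq_zero_iff_ae_notMem.mp hL] with s hs
  rw [kernelDensity_of_nonpos _ (by linarith [not_lt.mp (mt mem_Iio.mpr hs)])]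
  rfl

end MeasureConvolution

/-! ### The resolvent identity for shifted kernels. -/

section Resolvent

variable {K : ℝ → ℝ} {L : Measure ℝ}

theorem MonotoneCondition.isLocallyFiniteMeasure (hK : MonotoneCondition K L) :
    IsLocallyFiniteMeasure L := by
  refine ⟨fun x => ⟨Iic (x + 1), Iic_mem_nhds (by linarith), ?_⟩⟩
  calc L (Iic (x + 1)) ≤ L (Iio 0 ∪ Icc 0 (x + 1)) := by
        refine measure_mono fun y hy => ?_
        rcases lt_or_ge y 0 with h | h
        · exact Or.inl h
        · exact Or.inr ⟨h, hy⟩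
    _ ≤ L (Iio 0) + L (Icc 0 (x + 1)) := measure_union_le _ _
    _ < ∞ := by
        rw [hK.resolvent.support, zero_add]
        exact hK.resolvent.locallyFinite _

theorem MonotoneCondition.continuousOn_shift (hK : MonotoneCondition K L) {δ : ℝ} (hδ : 0 < δ) :
    ContinuousOn (shift δ K) (Ici 0) :=
  hK.continuous.comp (by fun_prop) fun x hx => by
    simp only [mem_Ici, mem_Ioi] at *
    linarith

theorem MonotoneCondition.conv_shift_nonneg (hK : MonotoneCondition K L) {δ : ℝ} (hδ : 0 < δ)
    (t : ℝ) : 0 ≤ conv (shift δ K) L t :=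
  setIntegral_nonneg measurableSet_Icc fun s hs => hK.nonneg _ (by linarith [hs.2])

theorem MonotoneCondition.integrableOn_kernel (hK : MonotoneCondition K L) {t : ℝ} (ht : 0 < t) :
    IntegrableOn (fun s => K (t - s)) (Icc 0 t) L := by
  by_contra hc
  have h1 := hK.resolvent.conv_eq_one t ht
  rw [conv, integral_undef hc] at h1
  exact zero_ne_one h1

/-- The left side is the part over `[0, t]` of the integral over `[0, t + δ]` that defines `(K *
L)(t + δ) = 1`. -/
theorem MonotoneCondition.conv_shift_le_one (hK : MonotoneCondition K L) {δ : ℝ} (hδ : 0 < δ)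
    {t : ℝ} (ht : 0 ≤ t) : conv (shift δ K) L t ≤ 1 := by
  have hz : L {t + δ} = 0 := hK.measure_singleton (by linarith)
  rw [← hK.resolvent.conv_eq_one (t + δ) (by linarith)]
  have h : conv (shift δ K) L t = ∫ s in Icc 0 t, K (t + δ - s) ∂L := by
    simp only [conv, shift]
    refine integral_congr_ae (Eventually.of_forall fun s => ?_)
    simp only
    congr 1
    ring
  rw [h, conv]
  refine setIntegral_mono_set (hK.integrableOn_kernel (by linarith)) ?_
    (Icc_subset_Icc le_rfl (by linarith)).eventuallyLE
  filter_upwards [ae_restrict_mem measurableSet_Icc,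
    ae_restrict_of_ae (measure_eq_zero_iff_ae_notMem.mp hz)] with s hs hs1
  exact hK.nonneg _ (sub_pos.mpr (lt_of_le_of_ne hs.2 hs1))

theorem MonotoneCondition.continuous_conv_shift (hK : MonotoneCondition K L) {δ : ℝ}
    (hδ : 0 < δ) : Continuous fun t => conv (shift δ K) L (max t 0) := by
  have := hK.isLocallyFiniteMeasure
  rw [← continuousOn_univ]
  exact (continuousOn_vconv (fun t ht => hK.measure_singleton ht)
    (hK.continuousOn_shift hδ)).comp (by fun_prop) fun x _ => mem_Ici.mpr (le_max_right _ _)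

/-- Continuity of `Δ_δ K * L` makes the right-continuous regularisation built into the Stieltjes
function trivial. -/
theorem MonotoneCondition.stieltjesMeasure_eq (hK : MonotoneCondition K L) {δ : ℝ}
    (hδ : 0 < δ) : ∃ f : StieltjesFunction ℝ, stieltjesMeasure (conv (shift δ K) L) = f.measure ∧
      ∀ t, f t = conv (shift δ K) L (max t 0) := by
  refine ⟨(monotone_conv_shift hK hδ).stieltjesFunction, ?_, fun t => ?_⟩
  · rw [stieltjesMeasure, dif_pos (monotone_conv_shift hK hδ)]
  · rw [Monotone.stieltjesFunction_eq]
    exact ((hK.continuous_conv_shift hδ).continuousAt.continuousWithinAt).rightLim_eq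

theorem MonotoneCondition.isLocallyFiniteMeasure_stieltjes (hK : MonotoneCondition K L) {δ : ℝ}
    (hδ : 0 < δ) : IsLocallyFiniteMeasure (stieltjesMeasure (conv (shift δ K) L)) := by
  obtain ⟨f, hf, -⟩ := hK.stieltjesMeasure_eq hδ
  rw [hf]
  infer_instance

theorem MonotoneCondition.stieltjesMeasure_Iio (hK : MonotoneCondition K L) {δ : ℝ}
    (hδ : 0 < δ) (t : ℝ) : stieltjesMeasure (conv (shift δ K) L) (Iio t)
      = ENNReal.ofReal (conv (shift δ K) L (max t 0) - conv (shift δ K) L 0) := by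
  obtain ⟨f, hf, hft⟩ := hK.stieltjesMeasure_eq hδ
  have hfc : (f : ℝ → ℝ) = fun t => conv (shift δ K) L (max t 0) := funext hft
  have hlim : Tendsto f atBot (𝓝 (conv (shift δ K) L 0)) := by
    refine tendsto_const_nhds.congr' ?_
    filter_upwards [Iic_mem_atBot (0 : ℝ)] with t ht
    rw [hft, max_eq_right ht]
  rw [hf, f.measure_Iio hlim, ← hft]
  congr 2
  refine ContinuousWithinAt.leftLim_eq ?_
  rw [hfc]
  exact (hK.continuous_conv_shift hδ).continuousAt.continuousWithinAt

theorem MonotoneCondition.stieltjesMeasure_Iic (hK : MonotoneCondition K L) {δ : ℝ}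
    (hδ : 0 < δ) (t : ℝ) : stieltjesMeasure (conv (shift δ K) L) (Iic t)
      = ENNReal.ofReal (conv (shift δ K) L (max t 0) - conv (shift δ K) L 0) := by
  obtain ⟨f, hf, hft⟩ := hK.stieltjesMeasure_eq hδ
  have hlim : Tendsto f atBot (𝓝 (conv (shift δ K) L 0)) := by
    refine tendsto_const_nhds.congr' ?_
    filter_upwards [Iic_mem_atBot (0 : ℝ)] with t ht
    rw [hft, max_eq_right ht]
  rw [hf, f.measure_Iic hlim, ← hft]

/-- The identity `Δ_δ K = (Δ_δ K * L)(0) K + d(Δ_δ K * L) * K`, in terms of measures. -/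
theorem MonotoneCondition.kernelMeasure_shift_eq (hK : MonotoneCondition K L)
    (hr : IsRegularKernel K) {δ : ℝ} (hδ : 0 < δ) :
    kernelMeasure (shift δ K) = ENNReal.ofReal (conv (shift δ K) L 0) • kernelMeasure K
      + (stieltjesMeasure (conv (shift δ K) L)).conv (kernelMeasure K) := by
  have hL := hK.isLocallyFiniteMeasure
  have hμl := hK.isLocallyFiniteMeasure_stieltjes hδ
  have hκ := hr.isLocallyFiniteMeasure
  have hκδ := (hr.shift_kernel hδ).isLocallyFiniteMeasure
  set F := conv (shift δ K) L with hF
  set μ := stieltjesMeasure F with hμ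
  set κ := kernelMeasure K with hκdef
  set κδ := kernelMeasure (shift δ K) with hκδdef
  set ν := (volume : Measure ℝ).restrict (Ioi 0) with hν
  have hne : ∀ᵐ t : ℝ, t ≠ 0 :=
    measure_eq_zero_iff_ae_notMem.mp (NullSingletonClass.measure_singleton (0 : ℝ))
  have h1 : κ.conv L = ν := by
    have hν' : ν = volume.withDensity ((Ioi 0).indicator 1) := by
      rw [withDensity_indicator_one measurableSet_Ioi]
    rw [hκdef, kernelMeasure, withDensity_conv_eq hr.measurable_kernelDensity, hν']
    refine withDensity_congr_ae ?_
    filter_upwards [hne] with t ht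
    rcases lt_or_gt_of_ne ht with h | h
    · rw [lintegral_kernelDensity_sub_of_neg hK.resolvent.support h,
        indicator_of_notMem (by simpa using h.le)]
    · rw [lintegral_kernelDensity_sub hK.nonneg hK.resolvent.support (hK.measure_singleton h)
        (hK.integrableOn_kernel h), hK.resolvent.conv_eq_one t h, indicator_of_mem (mem_Ioi.mpr h)]
      simp
  -- The atom of mass `F 0` at the origin makes `F` the distribution function of `α`: `α (Iio t)`
  -- corresponds to `F t` for `t > 0`, so `Δ_δ K * L = F` becomes an equality of measures with
  -- `ν.conv α`.
  set α := ENNReal.ofReal (F 0) • Measure.dirac (0 : ℝ) + μ with hα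
  have h2 : κδ.conv L = ν.conv α := by
    rw [hκδdef, kernelMeasure, withDensity_conv_eq (hr.shift_kernel hδ).measurable_kernelDensity,
      restrict_Ioi_conv_eq]
    refine withDensity_congr_ae ?_
    filter_upwards [hne] with t ht
    rw [hα, Measure.add_apply, Measure.smul_apply, hμ, hK.stieltjesMeasure_Iio hδ,
      Measure.dirac_apply' _ measurableSet_Iio, ← hF]
    rcases lt_or_gt_of_ne ht with h | h
    · rw [lintegral_kernelDensity_sub_of_neg hK.resolvent.support h,
        indicator_of_notMem (by simpa using h.le), max_eq_right h.le]
      simp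
    · rw [lintegral_kernelDensity_sub (hr.shift_kernel hδ).nonneg hK.resolvent.support
        (hK.measure_singleton h) (integrableOn_reflect
          ((hK.continuousOn_shift hδ).mono Icc_subset_Ici_self)), ← hF,
        indicator_of_mem (mem_Iio.mpr h), max_eq_left h.le, Pi.one_apply, smul_eq_mul, mul_one,
        ← ENNReal.ofReal_add (hK.conv_shift_nonneg hδ 0)]
      · congr 1
        ring
      · have := monotone_conv_shift hK hδ h.le
        simp only [max_self, max_eq_left h.le] at this
        linarith
  -- Associativity and `κ * L = ν` eliminate `L`; the factor `ν` is then cancelled by injectivity.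
  have h3 : ν.conv κδ = ν.conv (α.conv κ) := by
    calc ν.conv κδ = (κ.conv L).conv κδ := by rw [h1]
      _ = κ.conv (L.conv κδ) := Measure.conv_assoc _ _ _
      _ = κ.conv (ν.conv α) := by rw [Measure.conv_comm L, h2]
      _ = (ν.conv α).conv κ := Measure.conv_comm _ _
      _ = _ := Measure.conv_assoc _ _ _
  have h4 : α.conv κ = κδ := by
    refine eq_of_conv_restrict_Ioi_eq (fun t => ?_) h3.symm
    exact (measure_mono Iio_subset_Iic_self).trans_lt ((hr.shift_kernel hδ).kernelMeasure_Iic_lt_top t)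
  rw [← h4, hα, Measure.add_conv, Measure.conv_smul_left, Measure.dirac_zero_conv]

end Resolvent

/-! ### Forward curves and the positivity principle. -/

section ForwardCurves

variable {K : ℝ → ℝ} {L : Measure ℝ}

theorem IsRegularKernel.integrable_of_bounded {E : Type*} [NormedAddCommGroup E]
    (hr : IsRegularKernel K) {φ : ℝ → E}
    (hφ : AEStronglyMeasurable φ (kernelMeasure K)) {C R : ℝ} (hC : ∀ x, ‖φ x‖ ≤ C)
    (hR : ∀ x, R < x → φ x = 0) : Integrable φ (kernelMeasure K) := by
  have hsub : Function.support φ ⊆ Iic R := fun x hx => by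
    by_contra hc
    exact hx (hR x (not_le.mp hc))
  rw [← integrableOn_iff_integrable_of_support_subset hsub]
  exact Measure.integrableOn_of_bounded (hr.kernelMeasure_Iic_lt_top R).ne hφ
    (Eventually.of_forall hC)

theorem IsRegularKernel.setIntegral_kernelMeasure_shift {E : Type*} [NormedAddCommGroup E]
    [NormedSpace ℝ E] (hr : IsRegularKernel K) {δ : ℝ} (hδ : 0 < δ) (f : ℝ → E) {s : Set ℝ}
    (hs : MeasurableSet s) (hs0 : s ⊆ Ioi 0) :
    ∫ x in s, f x ∂(kernelMeasure (shift δ K))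
      = ∫ x in (fun x => x - δ) ⁻¹' s, f (x - δ) ∂(kernelMeasure K) := by
  rw [(hr.shift_kernel hδ).setIntegral_kernelMeasure f hs hs0, hr.setIntegral_kernelMeasure]
  · rw [← (measurePreserving_sub_right volume δ).setIntegral_preimage_emb
      (measurableEmbedding_subRight δ)]
    simp [shift]
  · exact hs.preimage (by fun_prop)
  · intro x hx
    have := mem_Ioi.mp (hs0 hx)
    exact mem_Ioi.mpr (by linarith)

/-- The identity `Δ_δ K = (Δ_δ K * L)(0) K + d(Δ_δ K * L) * K`, tested against a function. -/
theorem MonotoneCondition.integral_kernelMeasure_shift (hK : MonotoneCondition K L)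
    (hr : IsRegularKernel K) {δ : ℝ} (hδ : 0 < δ) {φ : ℝ → ℝ} (hφ : Measurable φ) {C R : ℝ}
    (hC : ∀ x, ‖φ x‖ ≤ C) (hR : ∀ x, R < x → φ x = 0) :
    Integrable (fun y => ∫ x, φ (y + x) ∂(kernelMeasure K))
        (stieltjesMeasure (conv (shift δ K) L)) ∧
      ∫ x, φ x ∂(kernelMeasure (shift δ K))
        = conv (shift δ K) L 0 * ∫ x, φ x ∂(kernelMeasure K)
          + ∫ y, ∫ x, φ (y + x) ∂(kernelMeasure K) ∂(stieltjesMeasure (conv (shift δ K) L)) := by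
  have hκ := hr.isLocallyFiniteMeasure
  have hμ := hK.isLocallyFiniteMeasure_stieltjes hδ
  have hint : Integrable φ (kernelMeasure (shift δ K)) :=
    (hr.shift_kernel hδ).integrable_of_bounded hφ.aestronglyMeasurable hC hR
  have heq := hK.kernelMeasure_shift_eq hr hδ
  rw [heq] at hint
  have h1 := hint.left_of_add_measure
  have h2 := hint.right_of_add_measure
  refine ⟨?_, ?_⟩
  · have h3 := (integrable_map_measure h2.aestronglyMeasurable
      (measurable_fst.add measurable_snd).aemeasurable).mp h2
    exact h3.integral_prod_left
  · rw [heq, integral_add_measure h1 h2, integral_smul_measure, ENNReal.toReal_ofReal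
      (hK.conv_shift_nonneg hδ 0), smul_eq_mul, integral_conv h2]

theorem integral_indicator_Iic_reflect {E : Type*} [NormedAddCommGroup E] [NormedSpace ℝ E]
    {κ : Measure ℝ} (hκ : κ (Iio 0) = 0) (Z : ℝ → E) (t : ℝ) :
    ∫ x, (Iic t).indicator (fun x => Z (t - x)) x ∂κ = vconv Z κ t := by
  rw [integral_indicator measurableSet_Iic, vconv]
  refine setIntegral_congr_set ?_
  have h0 := measure_eq_zero_iff_ae_notMem.mp hκ
  filter_upwards [h0] with x hx
  have hx : 0 ≤ x := not_lt.mp hx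
  exact propext ⟨fun h => ⟨hx, h⟩, fun h => h.2⟩

theorem kernelMeasure_Iio_zero (K : ℝ → ℝ) : kernelMeasure K (Iio 0) = 0 :=
  measure_mono_null Iio_subset_Iic_self (kernelMeasure_Iic_zero K)

theorem MonotoneCondition.stieltjesMeasure_Iio_zero (hK : MonotoneCondition K L) {δ : ℝ}
    (hδ : 0 < δ) : stieltjesMeasure (conv (shift δ K) L) (Iio 0) = 0 := by
  simp [hK.stieltjesMeasure_Iio hδ]

/-- Decomposition of the increments of a convolution with `K`. -/
theorem MonotoneCondition.conv_kernelMeasure_add (hK : MonotoneCondition K L)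
    (hr : IsRegularKernel K) {δ : ℝ} (hδ : 0 < δ) {Z : ℝ → ℝ} (hZ : Measurable Z) {C : ℝ}
    (hC : ∀ x, ‖Z x‖ ≤ C) {r : ℝ} (hr0 : 0 ≤ r) :
    IntegrableOn (fun s => conv Z (kernelMeasure K) (r - s)) (Icc 0 r)
        (stieltjesMeasure (conv (shift δ K) L)) ∧
      conv Z (kernelMeasure K) (r + δ)
        = (∫ s in Icc 0 δ, Z (r + δ - s) ∂(kernelMeasure K))
          + conv (shift δ K) L 0 * conv Z (kernelMeasure K) r
          + conv (conv Z (kernelMeasure K)) (stieltjesMeasure (conv (shift δ K) L)) r := by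
  have hκ := hr.isLocallyFiniteMeasure
  have hμ := hK.isLocallyFiniteMeasure_stieltjes hδ
  set μ := stieltjesMeasure (conv (shift δ K) L)
  -- Tested against this function, `K` gives `(K * Z)(r)`, while `Δ_δ K` gives the part of `(K *
  -- Z)(r + δ)` with `s > δ`, which involves `Z` only before time `r`. The part with `s ≤ δ` is the
  -- first term of the claim.
  set φ : ℝ → ℝ := (Iic r).indicator fun x => Z (r - x) with hφ
  have hC0 : 0 ≤ C := (norm_nonneg _).trans (hC 0)
  have hφb : ∀ x, ‖φ x‖ ≤ C := fun x => by
    by_cases hx : x ∈ Iic r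
    · rw [hφ, indicator_of_mem hx]
      exact hC _
    · rw [hφ, indicator_of_notMem hx, norm_zero]
      exact hC0
  obtain ⟨h1, h2⟩ := hK.integral_kernelMeasure_shift hr hδ (φ := φ) (C := C) (R := r)
    ((hZ.comp (by fun_prop)).indicator measurableSet_Iic) hφb
    (fun x hx => indicator_of_notMem (by simpa using hx) _)
  have hinner : ∀ y, ∫ x, φ (y + x) ∂(kernelMeasure K) = vconv Z (kernelMeasure K) (r - y) := by
    intro y
    rw [← integral_indicator_Iic_reflect (kernelMeasure_Iio_zero K)]
    congr 1
    ext x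
    simp only [hφ, indicator, mem_Iic]
    by_cases h : y + x ≤ r
    · rw [if_pos h, if_pos (by linarith)]
      congr 1
      ring
    · rw [if_neg h, if_neg (by linarith)]
  simp only [hinner] at h1 h2
  refine ⟨h1.integrableOn, ?_⟩
  have h3 : ∫ y, vconv Z (kernelMeasure K) (r - y) ∂μ = conv (conv Z (kernelMeasure K)) μ r := by
    rw [conv, ← integral_indicator measurableSet_Icc]
    refine integral_congr_ae ?_
    filter_upwards [measure_eq_zero_iff_ae_notMem.mp (hK.stieltjesMeasure_Iio_zero hδ)] with y hy
    have hy : 0 ≤ y := not_lt.mp hy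
    by_cases h : y ≤ r
    · rw [indicator_of_mem (show y ∈ Icc 0 r from ⟨hy, h⟩), vconv_eq_conv]
    · rw [indicator_of_notMem (fun hc => h hc.2), vconv, Icc_eq_empty (by linarith),
        Measure.restrict_empty, integral_zero_measure]
  have h4 : ∫ x, φ x ∂(kernelMeasure (shift δ K))
      = ∫ x in Ioc δ (r + δ), Z (r + δ - x) ∂(kernelMeasure K) := by
    rw [hφ, integral_indicator_Iic_reflect (kernelMeasure_Iio_zero _), vconv,
      integral_Icc_eq_integral_Ioc, hr.setIntegral_kernelMeasure_shift hδ _ measurableSet_Ioc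
        (fun x hx => hx.1)]
    have hpre : (fun x => x - δ) ⁻¹' Ioc 0 r = Ioc δ (r + δ) := by
      ext x
      simp only [mem_preimage, mem_Ioc]
      constructor <;> rintro ⟨h, h'⟩ <;> constructor <;> linarith
    rw [hpre]
    refine setIntegral_congr_fun measurableSet_Ioc fun x _ => ?_
    congr 1
    ring
  have h5 : ∫ x, φ x ∂(kernelMeasure K) = conv Z (kernelMeasure K) r :=
    integral_indicator_Iic_reflect (kernelMeasure_Iio_zero _) _ _
  rw [h3, h4, h5] at h2
  have hunion : Icc 0 (r + δ) = Icc 0 δ ∪ Ioc δ (r + δ) :=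
    (Icc_union_Ioc_eq_Icc hδ.le (by linarith)).symm
  have hI : IntegrableOn (fun s => Z (r + δ - s)) (Icc 0 (r + δ)) (kernelMeasure K) :=
    Measure.integrableOn_of_bounded measure_Icc_lt_top.ne
      (hZ.comp (by fun_prop)).aestronglyMeasurable (Eventually.of_forall fun s => hC _)
  rw [hunion] at hI
  rw [add_assoc, ← h2, conv, hunion, setIntegral_union _ measurableSet_Ioc hI.left_of_union
    hI.right_of_union]
  exact disjoint_left.mpr fun x hx hx' => not_lt.mpr hx.2 hx'.1

/-- The inequalities in the definition of `𝒢_K`. -/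
def IsForwardPositive (K : ℝ → ℝ) (L : Measure ℝ) (g : ℝ → ℝ) : Prop :=
  ∀ δ : ℝ, 0 < δ → ∀ t : ℝ, 0 ≤ t →
    0 ≤ shift δ g t - conv (shift δ K) L 0 * g t
      - conv g (stieltjesMeasure (conv (shift δ K) L)) t

theorem IsForwardPositive.add (hK : MonotoneCondition K L) {f g : ℝ → ℝ}
    (hfc : ContinuousOn f (Ici 0)) (hgc : ContinuousOn g (Ici 0))
    (hf : IsForwardPositive K L f) (hg : IsForwardPositive K L g) :
    IsForwardPositive K L fun t => f t + g t := by
  intro δ hδ t ht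
  have hμ := hK.isLocallyFiniteMeasure_stieltjes hδ
  have h1 := hf δ hδ t ht
  have h2 := hg δ hδ t ht
  have h3 : conv (fun t => f t + g t) (stieltjesMeasure (conv (shift δ K) L)) t
      = conv f (stieltjesMeasure (conv (shift δ K) L)) t
        + conv g (stieltjesMeasure (conv (shift δ K) L)) t :=
    vconv_add (hfc.mono Icc_subset_Ici_self) (hgc.mono Icc_subset_Ici_self)
  rw [h3]
  simp only [shift] at *
  linarith

/-- With `F = Δ_δ K * L` the inequality reduces to `c (1 - F(0) - (F(t) - F(0))) = c (1 - F(t)) ≥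
0`. -/
theorem IsForwardPositive.const (hK : MonotoneCondition K L) {c : ℝ} (hc : 0 ≤ c) :
    IsForwardPositive K L fun _ => c := by
  intro δ hδ t ht
  have h1 : stieltjesMeasure (conv (shift δ K) L) (Icc 0 t)
      ≤ ENNReal.ofReal (conv (shift δ K) L t - conv (shift δ K) L 0) := by
    have h := measure_mono (μ := stieltjesMeasure (conv (shift δ K) L))
      (Icc_subset_Iic_self (a := (0 : ℝ)) (b := t))
    rwa [hK.stieltjesMeasure_Iic hδ, max_eq_left ht] at h
  have hmono : conv (shift δ K) L 0 ≤ conv (shift δ K) L t := by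
    have := monotone_conv_shift hK hδ ht
    simpa only [max_self, max_eq_left ht] using this
  have h2 : (stieltjesMeasure (conv (shift δ K) L)).real (Icc 0 t)
      ≤ conv (shift δ K) L t - conv (shift δ K) L 0 :=
    ENNReal.toReal_le_of_le_ofReal (by linarith) h1
  have h3 := hK.conv_shift_le_one hδ ht
  simp only [shift, conv, setIntegral_const, smul_eq_mul] at *
  nlinarith

/-- The forward curve `t ↦ ∫₀^∞ f(ξ) K(t + ξ) dξ`. -/
noncomputable def forwardCurve {E : Type*} [NormedAddCommGroup E] [NormedSpace ℝ E] (K : ℝ → ℝ)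
    (f : ℝ → E) (t : ℝ) : E :=
  ∫ x in Ioi t, f (x - t) ∂(kernelMeasure K)

/-- The identity for `Δ_δ K`, tested against `f(· - t)` on `(t, ∞)`, is an equality in which the
Stieltjes integral runs over all `y ≥ 0`. The inequality of `𝒢_K` keeps only `y ≤ t`, and the
discarded part is non-negative. -/
theorem isForwardPositive_forwardCurve (hK : MonotoneCondition K L) (hr : IsRegularKernel K)
    {f : ℝ → ℝ} (hf : Measurable f) {C M : ℝ} (hC : ∀ x, ‖f x‖ ≤ C) (hM : ∀ x, M < x → f x = 0)
    (hf0 : ∀ x, 0 ≤ f x) : IsForwardPositive K L (forwardCurve K f) := by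
  intro δ hδ t ht
  have hC0 : 0 ≤ C := (norm_nonneg _).trans (hC 0)
  set μ := stieltjesMeasure (conv (shift δ K) L)
  set φ : ℝ → ℝ := (Ioi t).indicator fun x => f (x - t) with hφ
  have hφb : ∀ x, ‖φ x‖ ≤ C := fun x => by
    by_cases hx : x ∈ Ioi t
    · rw [hφ, indicator_of_mem hx]
      exact hC _
    · rw [hφ, indicator_of_notMem hx, norm_zero]
      exact hC0
  have hφM : ∀ x, M + t < x → φ x = 0 := fun x hx => by
    simp only [hφ, indicator, hM (x - t) (by linarith), ite_self]
  obtain ⟨h1, h2⟩ := hK.integral_kernelMeasure_shift hr hδ (φ := φ) (C := C) (R := M + t)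
    ((hf.comp (by fun_prop)).indicator measurableSet_Ioi) hφb hφM
  have hinner : ∀ y, ∫ x, φ (y + x) ∂(kernelMeasure K)
      = forwardCurve K f (t - y) := by
    intro y
    rw [forwardCurve, ← integral_indicator measurableSet_Ioi]
    congr 1
    ext x
    simp only [hφ, indicator, mem_Ioi]
    by_cases h : t < y + x
    · rw [if_pos h, if_pos (by linarith)]
      congr 1
      ring
    · rw [if_neg h, if_neg (by linarith)]
  simp only [hinner] at h1 h2
  have h3 : conv (forwardCurve K f) μ t
      ≤ ∫ y, forwardCurve K f (t - y) ∂μ := by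
    refine setIntegral_le_integral h1 (Eventually.of_forall fun y => ?_)
    exact setIntegral_nonneg measurableSet_Ioi fun x _ => hf0 _
  have h4 : ∫ x, φ x ∂(kernelMeasure (shift δ K))
      = forwardCurve K f (t + δ) := by
    rw [hφ, integral_indicator measurableSet_Ioi, hr.setIntegral_kernelMeasure_shift hδ _
      measurableSet_Ioi (Ioi_subset_Ioi ht), forwardCurve]
    have hpre : (fun x => x - δ) ⁻¹' Ioi t = Ioi (t + δ) := by
      ext x
      simp only [mem_preimage, mem_Ioi]
      constructor <;> intro h <;> linarith
    rw [hpre]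
    refine setIntegral_congr_fun measurableSet_Ioi fun x _ => ?_
    congr 1
    ring
  have h5 : ∫ x, φ x ∂(kernelMeasure K) = forwardCurve K f t := by
    rw [hφ, integral_indicator measurableSet_Ioi, forwardCurve]
  rw [h4, h5] at h2
  simp only [shift] at *
  linarith

/-- A lower bound for the increments of `G + K * Z`. -/
theorem IsForwardPositive.le_add_conv (hK : MonotoneCondition K L) (hr : IsRegularKernel K)
    {G : ℝ → ℝ} (hGc : ContinuousOn G (Ici 0)) (hG : IsForwardPositive K L G) {Z : ℝ → ℝ}
    (hZ : Measurable Z) {C : ℝ} (hC : ∀ x, ‖Z x‖ ≤ C) {δ : ℝ} (hδ : 0 < δ) {r : ℝ}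
    (hr0 : 0 ≤ r) :
    (∫ s in Icc 0 δ, Z (r + δ - s) ∂(kernelMeasure K))
        + conv (shift δ K) L 0 * (G r + conv Z (kernelMeasure K) r)
        + conv (fun s => G s + conv Z (kernelMeasure K) s)
            (stieltjesMeasure (conv (shift δ K) L)) r
      ≤ G (r + δ) + conv Z (kernelMeasure K) (r + δ) := by
  have hμ := hK.isLocallyFiniteMeasure_stieltjes hδ
  obtain ⟨h1, h2⟩ := hK.conv_kernelMeasure_add hr hδ hZ hC hr0
  have h3 := hG δ hδ r hr0
  have h4 : conv (fun s => G s + conv Z (kernelMeasure K) s)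
      (stieltjesMeasure (conv (shift δ K) L)) r
      = conv G (stieltjesMeasure (conv (shift δ K) L)) r
        + conv (conv Z (kernelMeasure K))
          (stieltjesMeasure (conv (shift δ K) L)) r :=
    integral_add (integrableOn_reflect (hGc.mono Icc_subset_Ici_self)) h1
  rw [h4]
  simp only [shift] at *
  linarith

/-- Continuous induction: at the infimum `τ` of the times where `X < 0`, continuity gives `X τ ≥ 0`,
and the step at `τ` contradicts the definition of `τ`. -/
theorem nonneg_of_forall_nonneg_right {X : ℝ → ℝ} {T : ℝ} (hX : ContinuousOn X (Icc 0 T))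
    (h0 : 0 ≤ X 0)
    (hstep : ∀ r ∈ Ico 0 T, (∀ s ∈ Icc 0 r, 0 ≤ X s) →
      ∃ η > 0, ∀ δ, 0 < δ → δ < η → r + δ ≤ T → 0 ≤ X (r + δ)) :
    ∀ t ∈ Icc 0 T, 0 ≤ X t := by
  by_contra! hc
  obtain ⟨t, ht, hXt⟩ := hc
  set A : Set ℝ := {s | s ∈ Icc 0 T ∧ X s < 0} with hA
  have hne : A.Nonempty := ⟨t, ht, hXt⟩
  have hbdd : BddBelow A := ⟨0, fun s hs => hs.1.1⟩
  set τ := sInf A with hτ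
  have hτ0 : 0 ≤ τ := le_csInf hne fun s hs => hs.1.1
  have hτt : τ ≤ t := csInf_le hbdd ⟨ht, hXt⟩
  have hτT : τ ∈ Icc 0 T := ⟨hτ0, hτt.trans ht.2⟩
  have hbefore : ∀ s, 0 ≤ s → s < τ → 0 ≤ X s := fun s hs hsτ => by
    by_contra! hneg
    exact not_le.mpr hsτ (csInf_le hbdd ⟨⟨hs, hsτ.le.trans hτT.2⟩, hneg⟩)
  have hXτ : 0 ≤ X τ := by
    by_contra! hneg
    have hpos : 0 < τ := lt_of_le_of_ne hτ0 fun h => by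
      rw [← h] at hneg
      linarith
    have hev : ∀ᶠ s in 𝓝[Icc 0 T] τ, X s < 0 := (hX τ hτT).eventually (Iio_mem_nhds hneg)
    have hle : 𝓝[Ico 0 τ] τ ≤ 𝓝[Icc 0 T] τ :=
      nhdsWithin_mono _ fun s hs => ⟨hs.1, hs.2.le.trans hτT.2⟩
    have hnb : (𝓝[Ico 0 τ] τ).NeBot := by
      rw [← mem_closure_iff_nhdsWithin_neBot, closure_Ico hpos.ne]
      exact ⟨hτ0, le_rfl⟩
    obtain ⟨s, hs1, hs2⟩ := ((hev.filter_mono hle).and self_mem_nhdsWithin).exists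
    exact not_le.mpr hs1 (hbefore s hs2.1 hs2.2)
  have hτlt : τ < T := lt_of_le_of_ne hτT.2 fun h => by
    have : τ = t := le_antisymm hτt (h ▸ ht.2)
    rw [this] at hXτ
    linarith
  obtain ⟨η, hη, hstepη⟩ := hstep τ ⟨hτ0, hτlt⟩ fun s hs => by
    rcases eq_or_lt_of_le hs.2 with h | h
    · rw [h]; exact hXτ
    · exact hbefore s hs.1 h
  obtain ⟨s, hsA, hs⟩ := exists_lt_of_csInf_lt hne (show sInf A < τ + η by linarith)
  have hτs : τ < s := lt_of_le_of_ne (csInf_le hbdd hsA) fun h => by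
    rw [← h] at hsA
    linarith [hsA.2]
  have := hstepη (s - τ) (by linarith) (by linarith) (by linarith [hsA.1.2])
  rw [add_sub_cancel] at this
  linarith [hsA.2]

/-- `G + K * Z` stays non-negative if `Z` is non-negative whenever `G + K * Z` is small. -/
theorem IsForwardPositive.nonneg_of_nonneg_near_zero (hK : MonotoneCondition K L)
    (hr : IsRegularKernel K) {G : ℝ → ℝ} (hGc : ContinuousOn G (Ici 0))
    (hG : IsForwardPositive K L G) (hG0 : 0 ≤ G 0) {T : ℝ} {X Z : ℝ → ℝ}
    (hXc : ContinuousOn X (Icc 0 T)) (hZc : ContinuousOn Z (Icc 0 T))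
    (hX : ∀ t ∈ Icc 0 T, X t = G t + conv Z (kernelMeasure K) t) {ε : ℝ} (hε : 0 < ε)
    (hZ : ∀ t ∈ Icc 0 T, |X t| < ε → 0 ≤ Z t) : ∀ t ∈ Icc 0 T, 0 ≤ X t := by
  have hκ := hr.isLocallyFiniteMeasure
  rcases lt_or_ge T 0 with hT | hT
  · intro t ht
    linarith [ht.1, ht.2]
  set Z' : ℝ → ℝ := IccExtend hT ((Icc 0 T).domRestrict Z) with hZ'
  have hZ'c : Continuous Z' := (continuousOn_iff_continuous_domRestrict.mp hZc).Icc_extend'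
  have hZ'eq : ∀ s ∈ Icc 0 T, Z' s = Z s := fun s hs => IccExtend_of_mem hT _ hs
  obtain ⟨C, hC⟩ := isCompact_Icc.exists_bound_of_continuousOn hZc
  have hZ'b : ∀ s, ‖Z' s‖ ≤ C := fun s => hC _ (projIcc 0 T hT s).2
  have hX' : ∀ t ∈ Icc 0 T, X t = G t + conv Z' (kernelMeasure K) t := fun t ht => by
    rw [hX t ht]
    congr 1
    exact vconv_congr fun s hs => (hZ'eq s ⟨hs.1, hs.2.trans ht.2⟩).symm
  refine nonneg_of_forall_nonneg_right hXc ?_ fun r hrT hpos => ?_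
  · rw [hX 0 ⟨le_rfl, hT⟩, conv, Icc_self, Measure.restrict_singleton]
    simpa using hG0
  have hrT' : r ∈ Icc 0 T := ⟨hrT.1, hrT.2.le⟩
  have hnhds : ∀ P : ℝ → Prop, (∀ᶠ s in 𝓝[Icc 0 T] r, P s) →
      ∃ η > 0, ∀ s, r ≤ s → s < r + η → s ≤ T → P s := by
    intro P hP
    obtain ⟨η, hη, hball⟩ := Metric.mem_nhdsWithin_iff.mp hP
    refine ⟨η, hη, fun s h1 h2 h3 => hball ⟨?_, ⟨hrT.1.trans h1, h3⟩⟩⟩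
    rw [Metric.mem_ball, Real.dist_eq, abs_of_nonneg (by linarith)]
    linarith
  -- If `X r = 0`, then `|X| < ε` just after `r`, so all terms of the lower bound for `X (r + δ)`
  -- are non-negative. If `X r > 0`, continuity suffices.
  rcases eq_or_lt_of_le (hpos r ⟨hrT.1, le_rfl⟩) with h0 | h0
  · have hev : ∀ᶠ s in 𝓝[Icc 0 T] r, |X s| < ε :=
      (hXc r hrT').abs.eventually (Iio_mem_nhds (by simpa [← h0] using hε))
    obtain ⟨η, hη, hlt⟩ := hnhds _ hev
    refine ⟨η, hη, fun δ hδ hδη hδT => ?_⟩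
    have h1 := IsForwardPositive.le_add_conv hK hr hGc hG hZ'c.measurable hZ'b hδ hrT.1
    rw [← hX' r hrT', ← hX' (r + δ) ⟨by linarith [hrT.1], hδT⟩, ← h0, mul_zero, add_zero] at h1
    have h2 : 0 ≤ ∫ s in Icc 0 δ, Z' (r + δ - s) ∂(kernelMeasure K) := by
      refine setIntegral_nonneg measurableSet_Icc fun s hs => ?_
      have hmem : r + δ - s ∈ Icc 0 T := ⟨by linarith [hrT.1, hs.2], by linarith [hs.1]⟩
      rw [hZ'eq _ hmem]
      exact hZ _ hmem (hlt _ (by linarith [hs.2]) (by linarith [hs.1]) hmem.2)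
    have h3 : 0 ≤ conv (fun s => G s + conv Z' (kernelMeasure K) s)
        (stieltjesMeasure (conv (shift δ K) L)) r := by
      rw [← vconv_eq_conv]
      refine vconv_nonneg fun s hs => ?_
      rw [← hX' s ⟨hs.1, hs.2.trans hrT'.2⟩]
      exact hpos s hs
    linarith
  · have hev : ∀ᶠ s in 𝓝[Icc 0 T] r, 0 < X s := (hXc r hrT').eventually (Ioi_mem_nhds h0)
    obtain ⟨η, hη, hlt⟩ := hnhds _ hev
    exact ⟨η, hη, fun δ hδ hδη hδT => (hlt _ (by linarith) (by linarith) hδT).le⟩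

/-- Positivity for convolution equations: if `X = G + K * Z` with `Z ≥ -c |X|`, then `X ≥ 0`. -/
theorem IsForwardPositive.nonneg (hK : MonotoneCondition K L)
    (hr : IsRegularKernel K) {G : ℝ → ℝ} (hGc : ContinuousOn G (Ici 0))
    (hG : IsForwardPositive K L G) (hG0 : 0 ≤ G 0) {T : ℝ} {X Z : ℝ → ℝ}
    (hXc : ContinuousOn X (Icc 0 T)) (hZc : ContinuousOn Z (Icc 0 T))
    (hX : ∀ t ∈ Icc 0 T, X t = G t + conv Z (kernelMeasure K) t) {c : ℝ} (hc : 0 ≤ c)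
    (hZ : ∀ t ∈ Icc 0 T, -(c * |X t|) ≤ Z t) : ∀ t ∈ Icc 0 T, 0 ≤ X t := by
  have hκ := hr.isLocallyFiniteMeasure
  rcases lt_or_ge T 0 with hT | hT
  · intro t ht
    linarith [ht.1, ht.2]
  set P : ℝ → ℝ := fun t => Z t + c * |X t| with hP
  have hPc : ContinuousOn P (Icc 0 T) := hZc.add (continuousOn_const.mul hXc.abs)
  have hP0 : ∀ t ∈ Icc 0 T, 0 ≤ P t := fun t ht => by
    have := hZ t ht
    simp only [hP]
    linarith
  set P' : ℝ → ℝ := IccExtend hT ((Icc 0 T).domRestrict P) with hP'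
  have hP'c : Continuous P' := (continuousOn_iff_continuous_domRestrict.mp hPc).Icc_extend'
  have hP'eq : ∀ s ∈ Icc 0 T, P' s = P s := fun s hs => IccExtend_of_mem hT _ hs
  obtain ⟨C, hC0, hC⟩ := exists_volterra_gronwall (kernelMeasure K) T hc
  have key : ∀ ε > 0, ∀ t ∈ Icc 0 T,
      -X t ≤ C * (c * (ε * (kernelMeasure K).real (Icc 0 T))) := by
    intro ε hε t ht
    -- On `[0, T]`, `X` solves the equation with drift `P - c |x|`, where `P ≥ 0`. Replacing `|x|`
    -- by `(|x| - ε)⁺` makes the drift non-negative for `|x| < ε`, so the perturbed solution `Y` is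
    -- non-negative; Gronwall shows that `X` and `Y` differ by `O(ε)`.
    set B : ℝ → ℝ → ℝ := fun t x => P' t - c * max (|x| - ε) 0 with hB
    have hBc : Continuous fun p : ℝ × ℝ => B p.1 p.2 := by
      simp only [hB]
      fun_prop
    obtain ⟨Y, hYc, hY⟩ := exists_volterra_solution (kernelMeasure K) hT hc
      (hGc.mono Icc_subset_Ici_self) hBc (fun t _ x y => by
        simp only [hB, Real.norm_eq_abs]
        have h1 : |max (|x| - ε) 0 - max (|y| - ε) 0| ≤ |x - y| := by
          refine (abs_max_sub_max_le_abs _ _ _).trans ?_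
          rw [sub_sub_sub_cancel_right]
          exact abs_abs_sub_abs_le _ _
        calc |P' t - c * max (|x| - ε) 0 - (P' t - c * max (|y| - ε) 0)|
            = |c * -(max (|x| - ε) 0 - max (|y| - ε) 0)| := by congr 1; ring
          _ = c * |max (|x| - ε) 0 - max (|y| - ε) 0| := by
              rw [abs_mul, abs_neg, abs_of_nonneg hc]
          _ ≤ c * |x - y| := by gcongr)
    have hBY : Continuous fun s => B s (Y s) := hBc.comp (continuous_id.prodMk hYc)
    have hY0 : ∀ t ∈ Icc 0 T, 0 ≤ Y t := by
      refine IsForwardPositive.nonneg_of_nonneg_near_zero hK hr hGc hG hG0 hYc.continuousOn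
        hBY.continuousOn hY hε fun s hs hlt => ?_
      simp only [hB]
      rw [max_eq_right (by linarith), mul_zero, sub_zero, hP'eq s hs]
      exact hP0 s hs
    have hdiff : ∀ t ∈ Icc 0 T, |X t - Y t|
        ≤ c * (ε * (kernelMeasure K).real (Icc 0 T))
          + c * vconv (fun s => |X s - Y s|) (kernelMeasure K) t := by
      intro t ht
      have hsub : Icc 0 t ⊆ Icc 0 T := Icc_subset_Icc le_rfl ht.2
      have h1 : X t - Y t = vconv (fun s => Z s - B s (Y s)) (kernelMeasure K) t := by
        rw [vconv_sub (hZc.mono hsub) hBY.continuousOn, hX t ht, hY t ht, ← vconv_eq_conv]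
        ring
      have hcont : ContinuousOn (fun s => |X s - Y s|) (Icc 0 t) :=
        ((hXc.mono hsub).sub hYc.continuousOn).abs
      rw [h1]
      calc |vconv (fun s => Z s - B s (Y s)) (kernelMeasure K) t|
          ≤ vconv (fun s => |Z s - B s (Y s)|) (kernelMeasure K) t :=
            norm_vconv_le (f := fun s => Z s - B s (Y s))
        _ ≤ vconv (fun s => c * ε + c * |X s - Y s|) (kernelMeasure K) t := by
            refine vconv_mono ((hZc.mono hsub).sub hBY.continuousOn).abs
              (continuousOn_const.add (continuousOn_const.mul hcont)) fun s hs => ?_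
            have h2 : Z s - B s (Y s) = c * (max (|Y s| - ε) 0 - |X s|) := by
              simp only [hB, hP'eq s (hsub hs), hP]
              ring
            rw [h2, abs_mul, abs_of_nonneg hc, ← mul_add]
            refine mul_le_mul_of_nonneg_left ?_ hc
            have h3 : |(|X s| - |Y s|)| ≤ |X s - Y s| := abs_abs_sub_abs_le _ _
            have h4 := abs_le.mp h3
            have h5 := abs_nonneg (X s)
            rw [abs_le]
            rcases le_total (|Y s| - ε) 0 with h | h
            · rw [max_eq_right h]
              constructor <;> linarith
            · rw [max_eq_left h]
              constructor <;> linarith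
        _ = c * ε * (kernelMeasure K).real (Icc 0 t)
            + c * vconv (fun s => |X s - Y s|) (kernelMeasure K) t := by
            rw [vconv_add (g := fun s => c * |X s - Y s|) continuousOn_const
              (continuousOn_const.mul hcont)]
            simp only [vconv, setIntegral_const, integral_const_mul, smul_eq_mul]
            ring
        _ ≤ _ := by
            have : (kernelMeasure K).real (Icc 0 t) ≤ (kernelMeasure K).real (Icc 0 T) :=
              measureReal_mono hsub measure_Icc_lt_top.ne
            rw [mul_assoc]
            gcongr
    have h1 := hC (fun s => |X s - Y s|) (c * (ε * (kernelMeasure K).real (Icc 0 T)))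
      (by positivity) (hXc.sub hYc.continuousOn).abs hdiff t ht
    have h2 := neg_abs_le (X t - Y t)
    have h3 := hY0 t ht
    linarith
  intro t ht
  by_contra! hneg
  set D := C * (c * (kernelMeasure K).real (Icc 0 T)) with hD
  have hD0 : 0 ≤ D := by positivity
  -- For this `ε` the bound reads `-X t ≤ -X t * D / (2 (D + 1))`, impossible for `-X t > 0`.
  have := key (-X t / (2 * (D + 1))) (by have : 0 < -X t := by linarith
                                         positivity) t ht
  have h2 : C * (c * (-X t / (2 * (D + 1)) * (kernelMeasure K).real (Icc 0 T)))
      = -X t * (D / (2 * (D + 1))) := by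
    rw [hD]; ring
  rw [h2] at this
  have h3 : D / (2 * (D + 1)) < 1 := by
    rw [div_lt_one (by positivity)]
    linarith
  nlinarith

end ForwardCurves

/-! ### Hölder regularity of forward curves and persistence of the inequalities. -/

section ForwardCurveRegularity

variable {K : ℝ → ℝ} {L : Measure ℝ} {γ : ℝ}

theorem IsRegularKernel.forwardCurve_eq_integral {E : Type*} [NormedAddCommGroup E]
    [NormedSpace ℝ E] (hr : IsRegularKernel K) (f : ℝ → E) {t : ℝ} (ht : 0 ≤ t) :
    forwardCurve K f t = ∫ ξ in Ioi (0 : ℝ), K (t + ξ) • f ξ := by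
  rw [forwardCurve, hr.setIntegral_kernelMeasure _ measurableSet_Ioi (Ioi_subset_Ioi ht),
    ← (measurePreserving_sub_right volume t).setIntegral_preimage_emb
      (measurableEmbedding_subRight t) _ (Ioi 0)]
  have hpre : (fun x => x - t) ⁻¹' Ioi 0 = Ioi t := by
    ext x
    simp
  rw [hpre]
  simp

theorem IsRegularKernel.integral_mul_kernel (hr : IsRegularKernel K) (f : ℝ → ℂ) {t : ℝ}
    (ht : 0 ≤ t) : ∫ ξ in Ioi (0 : ℝ), f ξ * (K (t + ξ) : ℂ) = forwardCurve K f t := by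
  rw [hr.forwardCurve_eq_integral f ht]
  refine integral_congr_ae (Eventually.of_forall fun ξ => ?_)
  simp only [Complex.real_smul, mul_comm]

theorem forwardCurve_congr {E : Type*} [NormedAddCommGroup E] [NormedSpace ℝ E] {f g : ℝ → E}
    (h : ∀ x, 0 ≤ x → f x = g x) (t : ℝ) : forwardCurve K f t = forwardCurve K g t :=
  setIntegral_congr_fun measurableSet_Ioi fun x hx => h _ (by linarith [mem_Ioi.mp hx])

theorem IsRegularKernel.integrable_forwardCurve {E : Type*} [NormedAddCommGroup E]
    [MeasurableSpace E] [BorelSpace E] [SecondCountableTopology E]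
    (hr : IsRegularKernel K) {f : ℝ → E} (hf : Measurable f) {C M : ℝ} (hC : ∀ x, ‖f x‖ ≤ C)
    (hM : ∀ x, M < x → f x = 0) (t : ℝ) :
    IntegrableOn (fun x => f (x - t)) (Ioi t) (kernelMeasure K) :=
  (hr.integrable_of_bounded (R := M + t)
    (hf.comp (measurable_id.sub_const t)).aestronglyMeasurable (fun x => hC _)
    (fun x hx => hM (x - t) (by linarith))).integrableOn

theorem IsRegularKernel.intervalIntegrable (hr : IsRegularKernel K) {a b : ℝ} (ha : 0 ≤ a)
    (hb : 0 ≤ b) : IntervalIntegrable K volume a b := by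
  rw [intervalIntegrable_iff]
  refine (hr.integrableOn (max a b)).mono_set fun x hx => ?_
  rw [uIoc, mem_Ioc] at hx
  exact ⟨lt_of_le_of_lt (le_min ha hb) hx.1, hx.2⟩

/-- Since `K` is non-increasing, the increments of the kernel have one sign and their integral
telescopes to `∫_s^{s+δ} K - ∫_{s+M}^{s+M+δ} K`, which is at most `∫_0^δ K`. -/
theorem MonotoneCondition.norm_forwardCurve_sub_le (hK : MonotoneCondition K L)
    (hr : IsRegularKernel K) {f : ℝ → ℝ} (hf : Measurable f) {C M : ℝ} (hC : ∀ x, ‖f x‖ ≤ C)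
    (hM0 : 0 ≤ M) (hM : ∀ x, M < x → f x = 0) {s δ : ℝ} (hs : 0 ≤ s) (hδ : 0 < δ) :
    ‖forwardCurve K f (s + δ) - forwardCurve K f s‖ ≤ C * ∫ x in (0 : ℝ)..δ, K x := by
  have hC0 : 0 ≤ C := (norm_nonneg _).trans (hC 0)
  have hrep : ∀ t, 0 ≤ t → forwardCurve K f t = ∫ ξ in (0 : ℝ)..M, K (t + ξ) • f ξ := by
    intro t ht
    rw [hr.forwardCurve_eq_integral f ht, intervalIntegral.integral_of_le hM0]
    refine (setIntegral_eq_of_subset_of_forall_sdiff_eq_zero measurableSet_Ioi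
      (fun x hx => hx.1) fun x hx => ?_)
    rw [hM x, smul_zero]
    by_contra hc
    exact hx.2 ⟨hx.1, not_lt.mp hc⟩
  have hKi : ∀ t, 0 ≤ t → IntervalIntegrable (fun ξ => K (t + ξ)) volume 0 M := by
    intro t ht
    have := (hr.intervalIntegrable (a := t + 0) (b := t + M) (by linarith)
      (by linarith)).comp_add_left (c := t)
    simpa using this
  have hi : ∀ t, 0 ≤ t → IntervalIntegrable (fun ξ => K (t + ξ) • f ξ) volume 0 M := by
    intro t ht
    simp only [smul_eq_mul]
    rw [intervalIntegrable_iff]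
    exact (intervalIntegrable_iff.mp (hKi t ht)).mul_bdd hf.aestronglyMeasurable
      (Eventually.of_forall hC)
  have hsδ : 0 ≤ s + δ := by linarith
  rw [hrep _ hsδ, hrep _ hs, ← intervalIntegral.integral_sub (hi _ hsδ) (hi _ hs)]
  calc ‖∫ ξ in (0 : ℝ)..M, (K (s + δ + ξ) • f ξ - K (s + ξ) • f ξ)‖
      ≤ ∫ ξ in (0 : ℝ)..M, C * (K (s + ξ) - K (s + δ + ξ)) := by
        refine intervalIntegral.norm_integral_le_of_norm_le hM0
          (Eventually.of_forall fun ξ hξ => ?_) (((hKi _ hs).sub (hKi _ hsδ)).const_mul C)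
        have h1 : K (s + δ + ξ) ≤ K (s + ξ) :=
          hK.antitone (mem_Ioi.mpr (by linarith [hξ.1])) (mem_Ioi.mpr (by linarith [hξ.1]))
            (by linarith)
        rw [← sub_smul, norm_smul, Real.norm_eq_abs, abs_of_nonpos (by linarith), mul_comm,
          neg_sub]
        exact mul_le_mul_of_nonneg_right (hC ξ) (by linarith)
    _ = C * ((∫ x in s..(s + M), K x) - ∫ x in (s + δ)..(s + δ + M), K x) := by
        rw [intervalIntegral.integral_const_mul, intervalIntegral.integral_sub (hKi _ hs)
          (hKi _ hsδ), intervalIntegral.integral_comp_add_left,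
          intervalIntegral.integral_comp_add_left]
        simp
    _ ≤ C * ∫ x in (0 : ℝ)..δ, K x := by
        refine mul_le_mul_of_nonneg_left ?_ hC0
        have e1 := intervalIntegral.integral_add_adjacent_intervals
          (hr.intervalIntegrable hs hsδ)
          (hr.intervalIntegrable (a := s + δ) (b := s + δ + M) hsδ (by linarith))
        have e2 := intervalIntegral.integral_add_adjacent_intervals
          (hr.intervalIntegrable (a := s) (b := s + M) hs (by linarith))
          (hr.intervalIntegrable (a := s + M) (b := s + δ + M) (by linarith) (by linarith))
        have e3 : 0 ≤ ∫ x in (s + M)..(s + δ + M), K x := by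
          rw [intervalIntegral.integral_of_le (by linarith)]
          exact setIntegral_nonneg measurableSet_Ioc fun x hx => hr.nonneg _ (by linarith [hx.1])
        have e4 : ∫ x in s..(s + δ), K x ≤ ∫ x in (0 : ℝ)..δ, K x := by
          have e5 : ∫ x in s..(s + δ), K x = ∫ x in (0 : ℝ)..δ, K (s + x) := by
            rw [intervalIntegral.integral_comp_add_left]
            simp
          have e6 : IntervalIntegrable (fun ξ => K (s + ξ)) volume 0 δ := by
            have := (hr.intervalIntegrable (a := s + 0) (b := s + δ) (by linarith)
              (by linarith)).comp_add_left (c := s)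
            simpa using this
          rw [e5]
          refine intervalIntegral.integral_mono_on_of_le_Ioo hδ.le e6
            (hr.intervalIntegrable le_rfl hδ.le) fun x hx => ?_
          exact hK.antitone (mem_Ioi.mpr hx.1) (mem_Ioi.mpr (by linarith [hx.1])) (by linarith)
        linarith

/-- Integrate `K ≤ K² / (2α) + α / 2` with `α = δ^{γ/2}` and use the bound on `∫_0^δ K²` from the
modulus condition. -/
theorem IsAdmissibleKernel.exists_integral_le (hK : IsAdmissibleKernel K γ L) {T : ℝ}
    (hT : 0 ≤ T) : ∃ C : ℝ, 0 ≤ C ∧ ∀ δ, 0 < δ → δ ≤ T →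
      ∫ x in (0 : ℝ)..δ, K x ≤ C * δ ^ (γ / 2) := by
  obtain ⟨c, hc0, -, hc⟩ := hK.modulus
  refine ⟨(c T + T) / 2, by linarith [hc0 T hT], fun δ hδ hδT => ?_⟩
  have h1 : ∫ t in (0 : ℝ)..δ, |K t| ^ 2 ≤ c T * δ ^ γ := by
    have h2 : 0 ≤ ∫ t in (0 : ℝ)..(T - δ), |K (t + δ) - K t| ^ 2 :=
      intervalIntegral.integral_nonneg (by linarith) fun x _ => by positivity
    linarith [hc T δ hδ hδT]
  set α : ℝ := δ ^ (γ / 2) with hα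
  have hα0 : 0 < α := Real.rpow_pos_of_pos hδ _
  have hγ : δ ^ γ = α * α := by
    rw [hα, ← Real.rpow_add hδ]
    congr 1
    ring
  have hsq : IntervalIntegrable (fun t => |K t| ^ 2) volume 0 δ := by
    rw [intervalIntegrable_iff, uIoc_of_le hδ.le]
    exact (hK.sq_integrable δ hδ).integrable_norm_pow (by norm_num)
  calc ∫ x in (0 : ℝ)..δ, K x ≤ ∫ x in (0 : ℝ)..δ, (α⁻¹ / 2 * |K x| ^ 2 + α / 2) := by
        refine intervalIntegral.integral_mono_on hδ.le
          (hK.isRegularKernel.intervalIntegrable le_rfl hδ.le)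
          ((hsq.const_mul _).add intervalIntegrable_const) fun x _ => ?_
        have h2 : α⁻¹ / 2 * |K x| ^ 2 + α / 2 - |K x| = α⁻¹ / 2 * (|K x| - α) ^ 2 := by
          field_simp
          ring
        have h3 : 0 ≤ α⁻¹ / 2 * (|K x| - α) ^ 2 := by positivity
        linarith [le_abs_self (K x)]
    _ = α⁻¹ / 2 * (∫ x in (0 : ℝ)..δ, |K x| ^ 2) + δ * (α / 2) := by
        rw [intervalIntegral.integral_add (hsq.const_mul _) intervalIntegrable_const,
          intervalIntegral.integral_const_mul, intervalIntegral.integral_const]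
        simp
    _ ≤ α⁻¹ / 2 * (c T * (α * α)) + T * (α / 2) := by
        rw [hγ] at h1
        gcongr
    _ = (c T + T) / 2 * α := by
        field_simp

theorem memHolderBelow_of_le {β : ℝ} {g : ℝ → ℝ}
    (h : ∀ T, 0 ≤ T → ∃ C, 0 ≤ C ∧ ∀ s δ, 0 ≤ s → 0 < δ → s + δ ≤ T →
      |g (s + δ) - g s| ≤ C * δ ^ β) : MemHolderBelow β g := by
  intro r hr T
  rcases lt_or_ge T 0 with hT | hT
  · refine ⟨0, fun x hx => ?_⟩
    linarith [hx.1, hx.2]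
  obtain ⟨C, hC0, hC⟩ := h T hT
  set D : ℝ := C * T ^ (β - r) with hD
  have hD0 : 0 ≤ D := mul_nonneg hC0 (Real.rpow_nonneg hT _)
  have key : ∀ x ∈ Icc 0 T, ∀ y ∈ Icc 0 T, x < y → dist (g x) (g y) ≤ D * dist x y ^ (r : ℝ) := by
    intro x hx y hy hxy
    have hδ : 0 < y - x := by linarith
    have h1 := hC x (y - x) hx.1 hδ (by linarith [hy.2])
    rw [add_sub_cancel] at h1
    rw [dist_comm, Real.dist_eq, dist_comm, Real.dist_eq, abs_of_pos hδ]
    refine h1.trans ?_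
    have h2 : (y - x) ^ β = (y - x) ^ (β - r) * (y - x) ^ (r : ℝ) := by
      rw [← Real.rpow_add hδ, sub_add_cancel]
    have h3 : (y - x) ^ (β - r) ≤ T ^ (β - r) :=
      Real.rpow_le_rpow hδ.le (by linarith [hx.1, hy.2]) (by linarith)
    rw [h2, hD, mul_assoc]
    gcongr
  have key' : ∀ x ∈ Icc 0 T, ∀ y ∈ Icc 0 T, dist (g x) (g y) ≤ D * dist x y ^ (r : ℝ) := by
    intro x hx y hy
    rcases lt_trichotomy x y with h | h | h
    · exact key x hx y hy h
    · rw [h, dist_self, dist_self]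
      exact mul_nonneg hD0 (Real.rpow_nonneg le_rfl _)
    · rw [dist_comm, dist_comm x]
      exact key y hy x hx h
  refine ⟨D.toNNReal, fun x hx y hy => ?_⟩
  rw [edist_dist, edist_dist, ENNReal.ofReal_rpow_of_nonneg dist_nonneg r.coe_nonneg]
  exact (ENNReal.ofReal_le_ofReal (key' x hx y hy)).trans_eq (ENNReal.ofReal_mul hD0)

theorem MemHolderBelow.continuousOn {β : ℝ} (hβ : 0 < β) {g : ℝ → ℝ} (h : MemHolderBelow β g) :
    ContinuousOn g (Ici 0) := by
  intro t ht
  obtain ⟨C, hC⟩ := h ⟨β / 2, by linarith⟩ (by change β / 2 < β; linarith) (t + 1)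
  have h1 : ContinuousOn g (Icc 0 (t + 1)) := hC.continuousOn (by
    change (0 : ℝ) < β / 2
    linarith)
  have h2 := h1 t ⟨ht, by linarith⟩
  refine h2.mono_of_mem_nhdsWithin ?_
  filter_upwards [self_mem_nhdsWithin,
    mem_nhdsWithin_of_mem_nhds (Iio_mem_nhds (by linarith : t < t + 1))] with x hx hx'
  exact ⟨hx, le_of_lt hx'⟩

theorem IsAdmissibleKernel.memHolderBelow_forwardCurve (hK : IsAdmissibleKernel K γ L)
    {f : ℝ → ℝ} (hf : Measurable f) {C M : ℝ} (hC : ∀ x, ‖f x‖ ≤ C)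
    (hM : ∀ x, M < x → f x = 0) : MemHolderBelow (γ / 2) (forwardCurve K f) := by
  refine memHolderBelow_of_le fun T hT => ?_
  have hC0 : 0 ≤ C := (norm_nonneg _).trans (hC 0)
  obtain ⟨D, hD0, hD⟩ := hK.exists_integral_le hT
  refine ⟨C * D, by positivity, fun s δ hs hδ hsδ => ?_⟩
  refine (hK.monotone.norm_forwardCurve_sub_le hK.isRegularKernel hf hC (le_max_right M 0)
    (fun x hx => hM x ((le_max_left _ _).trans_lt hx)) hs hδ).trans ?_
  rw [mul_assoc]
  exact mul_le_mul_of_nonneg_left (hD δ hδ (by linarith)) hC0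

theorem IsAdmissibleKernel.continuousOn_forwardCurve (hK : IsAdmissibleKernel K γ L)
    {f : ℝ → ℝ} (hf : Measurable f) {C M : ℝ} (hC : ∀ x, ‖f x‖ ≤ C)
    (hM : ∀ x, M < x → f x = 0) : ContinuousOn (forwardCurve K f) (Ici 0) :=
  (hK.memHolderBelow_forwardCurve hf hC hM).continuousOn (by linarith [hK.gamma_mem.1])

theorem IsRegularKernel.re_forwardCurve (hr : IsRegularKernel K) {f : ℝ → ℂ} (hf : Measurable f)
    {C M : ℝ} (hC : ∀ x, ‖f x‖ ≤ C) (hM : ∀ x, M < x → f x = 0) (t : ℝ) :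
    (forwardCurve K f t).re = forwardCurve K (fun x => (f x).re) t :=
  (Complex.reCLM.integral_comp_comm (hr.integrable_forwardCurve hf hC hM t)).symm

theorem IsRegularKernel.im_forwardCurve (hr : IsRegularKernel K) {f : ℝ → ℂ} (hf : Measurable f)
    {C M : ℝ} (hC : ∀ x, ‖f x‖ ≤ C) (hM : ∀ x, M < x → f x = 0) (t : ℝ) :
    (forwardCurve K f t).im = forwardCurve K (fun x => (f x).im) t :=
  (Complex.imCLM.integral_comp_comm (hr.integrable_forwardCurve hf hC hM t)).symm

theorem IsAdmissibleKernel.memHolderBelow_neg_re_forwardCurve (hK : IsAdmissibleKernel K γ L)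
    {f : ℝ → ℂ} (hf : Measurable f) {C M : ℝ} (hC : ∀ x, ‖f x‖ ≤ C)
    (hM : ∀ x, M < x → f x = 0) :
    MemHolderBelow (γ / 2) fun t => -(forwardCurve K f t).re := by
  have h : (fun t => -(forwardCurve K f t).re) = forwardCurve K fun x => -(f x).re := by
    ext t
    rw [hK.isRegularKernel.re_forwardCurve hf hC hM, forwardCurve, forwardCurve, ← integral_neg]
  rw [h]
  exact hK.memHolderBelow_forwardCurve (C := C) (M := M) (Complex.measurable_re.comp hf).neg
    (fun x => by rw [norm_neg]; exact (Complex.abs_re_le_norm _).trans (hC x))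
    (fun x hx => by rw [hM x hx]; simp)

theorem IsAdmissibleKernel.continuousOn_im_forwardCurve (hK : IsAdmissibleKernel K γ L)
    {f : ℝ → ℂ} (hf : Measurable f) {C M : ℝ} (hC : ∀ x, ‖f x‖ ≤ C)
    (hM : ∀ x, M < x → f x = 0) : ContinuousOn (fun t => (forwardCurve K f t).im) (Ici 0) := by
  have h : (fun t => (forwardCurve K f t).im) = forwardCurve K fun x => (f x).im :=
    funext fun t => hK.isRegularKernel.im_forwardCurve hf hC hM t
  rw [h]
  exact hK.continuousOn_forwardCurve (C := C) (M := M) (Complex.measurable_im.comp hf)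
    (fun x => (Complex.abs_im_le_norm _).trans (hC x)) (fun x hx => by rw [hM x hx]; simp)

theorem IsAdmissibleKernel.continuousOn_complex_forwardCurve (hK : IsAdmissibleKernel K γ L)
    {f : ℝ → ℂ} (hf : Measurable f) {C M : ℝ} (hC : ∀ x, ‖f x‖ ≤ C)
    (hM : ∀ x, M < x → f x = 0) : ContinuousOn (forwardCurve K f) (Ici 0) := by
  have h1 := ((hK.memHolderBelow_neg_re_forwardCurve hf hC hM).continuousOn
    (by linarith [hK.gamma_mem.1])).neg
  have h2 := hK.continuousOn_im_forwardCurve hf hC hM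
  have h3 : forwardCurve K f = fun t => ((- -(forwardCurve K f t).re : ℝ) : ℂ)
      + ((forwardCurve K f t).im : ℂ) * Complex.I := by
    ext t
    rw [neg_neg, Complex.re_add_im]
  rw [h3]
  exact (Complex.continuous_ofReal.comp_continuousOn h1).add
    ((Complex.continuous_ofReal.comp_continuousOn h2).mul continuousOn_const)

theorem re_vconv {κ : Measure ℝ} [IsLocallyFiniteMeasure κ] {f : ℝ → ℂ} {t : ℝ}
    (hf : ContinuousOn f (Icc 0 t)) : (vconv f κ t).re = conv (fun s => (f s).re) κ t :=
  (Complex.reCLM.integral_comp_comm (integrableOn_reflect hf)).symm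

theorem im_vconv {κ : Measure ℝ} [IsLocallyFiniteMeasure κ] {f : ℝ → ℂ} {t : ℝ}
    (hf : ContinuousOn f (Icc 0 t)) : (vconv f κ t).im = conv (fun s => (f s).im) κ t :=
  (Complex.imCLM.integral_comp_comm (integrableOn_reflect hf)).symm

/-- Past the time up to which `Z` acts, `G + K * Z` satisfies the inequalities in the definition of
`𝒢_K`, provided that it was non-negative until then. -/
theorem IsForwardPositive.shift_add_conv (hK : MonotoneCondition K L) (hr : IsRegularKernel K)
    {G : ℝ → ℝ} (hGc : ContinuousOn G (Ici 0)) (hG : IsForwardPositive K L G) {Z : ℝ → ℝ}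
    (hZ : Measurable Z) {C : ℝ} (hC : ∀ x, ‖Z x‖ ≤ C) {t : ℝ} (ht : 0 ≤ t)
    (hZt : ∀ u, t ≤ u → Z u = 0)
    (hpos : ∀ r ∈ Icc 0 t, 0 ≤ G r + conv Z (kernelMeasure K) r) :
    IsForwardPositive K L fun s => G (t + s) + conv Z (kernelMeasure K) (t + s) := by
  -- From a starting time `r ≥ t` the window `[r, r + δ]` contributes nothing, because `Z` vanishes
  -- there. Taking `r = t` first gives non-negativity at all later times.
  have hstep : ∀ r, t ≤ r → ∀ δ, 0 < δ →
      conv (shift δ K) L 0 * (G r + conv Z (kernelMeasure K) r)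
        + conv (fun s => G s + conv Z (kernelMeasure K) s)
            (stieltjesMeasure (conv (shift δ K) L)) r
      ≤ G (r + δ) + conv Z (kernelMeasure K) (r + δ) := by
    intro r htr δ hδ
    have h1 := IsForwardPositive.le_add_conv hK hr hGc hG hZ hC hδ (ht.trans htr)
    have h2 : ∫ s in Icc 0 δ, Z (r + δ - s) ∂(kernelMeasure K) = 0 := by
      rw [setIntegral_congr_fun (g := fun _ => (0 : ℝ)) measurableSet_Icc fun s hs =>
        hZt _ (by linarith [hs.2]), integral_zero]
    linarith
  have hpos' : ∀ r, 0 ≤ r → 0 ≤ G r + conv Z (kernelMeasure K) r := by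
    intro r hr0
    rcases le_or_gt r t with h | h
    · exact hpos r ⟨hr0, h⟩
    · have h1 := hstep t le_rfl (r - t) (by linarith)
      rw [add_sub_cancel] at h1
      have h2 := mul_nonneg (hK.conv_shift_nonneg (δ := r - t) (by linarith) 0)
        (hpos t ⟨ht, le_rfl⟩)
      have h3 : 0 ≤ conv (fun s => G s + conv Z (kernelMeasure K) s)
          (stieltjesMeasure (conv (shift (r - t) K) L)) t := by
        rw [← vconv_eq_conv]
        exact vconv_nonneg hpos
      linarith
  intro δ hδ s hs
  have hμ := hK.isLocallyFiniteMeasure_stieltjes hδ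
  have h1 := hstep (t + s) (by linarith) δ hδ
  -- Restarting at `t` shortens the integration range from `[0, t + s]` to `[0, s]`; this only
  -- decreases the integral, since the curve is non-negative at all times.
  have h2 : conv (fun s => G (t + s) + conv Z (kernelMeasure K) (t + s))
      (stieltjesMeasure (conv (shift δ K) L)) s
      ≤ conv (fun s => G s + conv Z (kernelMeasure K) s)
        (stieltjesMeasure (conv (shift δ K) L)) (t + s) := by
    have h3 : IntegrableOn (fun u => G (t + s - u) + conv Z (kernelMeasure K) (t + s - u))
        (Icc 0 (t + s)) (stieltjesMeasure (conv (shift δ K) L)) :=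
      (integrableOn_reflect (hGc.mono Icc_subset_Ici_self)).add
        (hK.conv_kernelMeasure_add hr hδ hZ hC (by linarith)).1
    simp only [conv] at h3 ⊢
    simp only [← add_sub_assoc]
    refine setIntegral_mono_set h3 ?_ (Icc_subset_Icc le_rfl (by linarith)).eventuallyLE
    filter_upwards [ae_restrict_mem measurableSet_Icc] with u hu
    exact hpos' _ (by linarith [hu.2])
  simp only [shift] at *
  rw [← add_assoc]
  linarith

end ForwardCurveRegularity

/-! ### A priori bounds and global existence for the scalar Riccati–Volterra equation. -/

section Riccati

variable {K : ℝ → ℝ} {L : Measure ℝ} {γ : ℝ}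

theorem riccatiOp_re (ρ η lam : ℝ) (w φ : ℂ) : (riccatiOp ρ η lam w φ).re
    = -((w.re - w.re ^ 2 + w.im ^ 2) / 2 + (ρ * η * w.re - lam) * (-φ.re) + ρ * η * w.im * φ.im
      - η ^ 2 / 2 * (φ.re ^ 2 - φ.im ^ 2)) := by
  simp only [riccatiOp, pow_two, Complex.add_re, Complex.sub_re, Complex.mul_re, Complex.mul_im,
    Complex.add_im, Complex.sub_im, Complex.div_ofNat_re, Complex.div_ofNat_im, Complex.ofReal_re,
    Complex.ofReal_im]
  ring

theorem riccatiOp_im (ρ η lam : ℝ) (w φ : ℂ) : (riccatiOp ρ η lam w φ).im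
    = (w.re * w.im - w.im / 2) + (ρ * η * w.re - lam) * φ.im + ρ * η * w.im * φ.re
      + η ^ 2 * φ.re * φ.im := by
  simp only [riccatiOp, pow_two, Complex.add_re, Complex.sub_re, Complex.mul_re, Complex.mul_im,
    Complex.add_im, Complex.sub_im, Complex.div_ofNat_re, Complex.div_ofNat_im, Complex.ofReal_re,
    Complex.ofReal_im]
  ring

theorem continuous_riccatiOp (ρ η lam : ℝ) (w : ℂ) : Continuous (riccatiOp ρ η lam w) := by
  unfold riccatiOp
  fun_prop

theorem exists_riccatiOp_lipschitz (ρ η lam : ℝ) (w : ℂ) {M : ℝ} (hM : 0 ≤ M) :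
    ∃ ℓ : ℝ, 0 ≤ ℓ ∧ ∀ φ χ : ℂ, ‖φ‖ ≤ M → ‖χ‖ ≤ M →
      ‖riccatiOp ρ η lam w φ - riccatiOp ρ η lam w χ‖ ≤ ℓ * ‖φ - χ‖ := by
  refine ⟨‖(ρ : ℂ) * η * w - lam‖ + ‖(η : ℂ) ^ 2 / 2‖ * (2 * M), by positivity,
    fun φ χ hφ hχ => ?_⟩
  have h : riccatiOp ρ η lam w φ - riccatiOp ρ η lam w χ
      = ((ρ : ℂ) * η * w - lam + (η : ℂ) ^ 2 / 2 * (φ + χ)) * (φ - χ) := by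
    unfold riccatiOp
    ring
  rw [h, norm_mul]
  refine mul_le_mul_of_nonneg_right ((norm_add_le _ _).trans ?_) (norm_nonneg _)
  rw [norm_mul ((η : ℂ) ^ 2 / 2)]
  have := norm_add_le φ χ
  gcongr
  linarith

/-- The projection of `ℂ` onto the rectangle `[-N, 0] × [-N, N]`. -/
def rectProj (N : ℝ) (z : ℂ) : ℂ := ⟨-max 0 (min N (-z.re)), max (-N) (min N z.im)⟩

theorem norm_rectProj_le {N : ℝ} (hN : 0 ≤ N) (z : ℂ) : ‖rectProj N z‖ ≤ N + N := by
  refine (Complex.norm_le_abs_re_add_abs_im _).trans (add_le_add ?_ ?_)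
  · simp only [rectProj, abs_neg]
    rw [abs_of_nonneg (le_max_left _ _)]
    exact max_le hN (min_le_left _ _)
  · rw [abs_le]
    exact ⟨le_max_left _ _, max_le (by linarith) (min_le_left _ _)⟩

theorem abs_clamp_sub_clamp_le (A B x y : ℝ) :
    |max A (min B x) - max A (min B y)| ≤ |x - y| := by
  refine (abs_max_sub_max_le_max _ _ _ _).trans ?_
  rw [sub_self, abs_zero, max_eq_right (abs_nonneg _)]
  refine (abs_min_sub_min_le_max _ _ _ _).trans ?_
  rw [sub_self, abs_zero, max_eq_right (abs_nonneg _)]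

theorem norm_rectProj_sub_le (N : ℝ) (z z' : ℂ) :
    ‖rectProj N z - rectProj N z'‖ ≤ 2 * ‖z - z'‖ := by
  refine (Complex.norm_le_abs_re_add_abs_im _).trans ?_
  have h1 : |(rectProj N z - rectProj N z').re| ≤ ‖z - z'‖ := by
    refine le_trans ?_ (Complex.abs_re_le_norm (z - z'))
    have h := abs_clamp_sub_clamp_le 0 N (-z.re) (-z'.re)
    rw [Complex.sub_re, Complex.sub_re, abs_sub_comm]
    calc |(rectProj N z').re - (rectProj N z).re|
        = |max 0 (min N (-z.re)) - max 0 (min N (-z'.re))| := by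
          simp only [rectProj]
          congr 1
          ring
      _ ≤ |-z.re - -z'.re| := h
      _ = |z.re - z'.re| := by
          rw [← abs_neg]
          congr 1
          ring
  have h2 : |(rectProj N z - rectProj N z').im| ≤ ‖z - z'‖ := by
    refine le_trans ?_ (Complex.abs_im_le_norm (z - z'))
    rw [Complex.sub_im, Complex.sub_im]
    exact abs_clamp_sub_clamp_le _ _ _ _
  linarith

theorem continuous_rectProj (N : ℝ) : Continuous (rectProj N) := by
  refine (LipschitzWith.of_dist_le_mul (K := 2) fun z z' => ?_).continuous
  rw [dist_eq_norm, dist_eq_norm]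
  exact norm_rectProj_sub_le N z z'

theorem quadraticForm_nonneg {ρ : ℝ} (hρ : ρ ∈ Icc (-1 : ℝ) 1) (b z : ℝ) :
    0 ≤ b ^ 2 + 2 * (ρ * b * z) + z ^ 2 := by
  have h1 : 0 ≤ 1 - ρ ^ 2 := by nlinarith [hρ.1, hρ.2]
  have h2 : b ^ 2 + 2 * (ρ * b * z) + z ^ 2 = (1 - ρ ^ 2) * b ^ 2 + (ρ * b + z) ^ 2 := by ring
  rw [h2]
  positivity

theorem abs_mul_le_of_mem_Icc {ρ : ℝ} (hρ : ρ ∈ Icc (-1 : ℝ) 1) (b : ℝ) : |ρ * b| ≤ |b| := by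
  rw [abs_mul]
  exact mul_le_of_le_one_left (abs_nonneg b) (abs_le.mpr hρ)

/-- With `b = Im w` and `y = Im φ`, the part of `-Re ℛ` free of `Re φ` is half of `Re w - (Re w)² +
b² + 2ρbηy + (ηy)²`, non-negative under the assumptions on `ρ` and `w`. The other terms are at most
a constant times `|x|` in size. The constant may depend on the truncation level `N`, as positivity
does not see it. -/
theorem neg_mul_le_neg_riccatiOp_re {ρ : ℝ} (hρ : ρ ∈ Icc (-1 : ℝ) 1) (η lam : ℝ) {w : ℂ}
    (hw : w.re ∈ Icc (0 : ℝ) 1) {φ : ℂ} {N x : ℝ} (h0 : 0 ≤ -φ.re) (hN : -φ.re ≤ N)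
    (hx : -φ.re ≤ |x|) :
    -((|ρ * η * w.re - lam| + η ^ 2 / 2 * N) * |x|) ≤ -(riccatiOp ρ η lam w φ).re := by
  have haa : 0 ≤ w.re - w.re ^ 2 := by nlinarith [hw.1, hw.2]
  rw [riccatiOp_re, neg_neg, ← neg_sq φ.re]
  have h1 := quadraticForm_nonneg hρ w.im (η * φ.im)
  generalize -φ.re = v at *
  generalize ρ * η * w.re - lam = c
  have h6 : -(|c| * |x|) ≤ c * v := by
    have h7 : -|c| * v ≤ c * v := mul_le_mul_of_nonneg_right (neg_abs_le c) h0
    have h8 := mul_le_mul_of_nonneg_left hx (abs_nonneg c)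
    linarith
  have h9 : η ^ 2 / 2 * v ^ 2 ≤ η ^ 2 / 2 * N * |x| := by
    have := h0.trans hN
    rw [pow_two v, mul_assoc]
    gcongr
  linarith

/-- The quadratic term in `Re φ` has a favourable sign and is dropped. What remains is affine in `x`
with coefficients free of `N`, as Gronwall requires. -/
theorem neg_riccatiOp_re_le (ρ η lam : ℝ) {w φ : ℂ} {Y x : ℝ} (h0 : 0 ≤ -φ.re)
    (hx : -φ.re ≤ x) (hY : |φ.im| ≤ Y) :
    -(riccatiOp ρ η lam w φ).re ≤ (w.re - w.re ^ 2 + w.im ^ 2) / 2 + |ρ * η * w.im| * Y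
      + η ^ 2 / 2 * Y ^ 2 + |ρ * η * w.re - lam| * x := by
  rw [riccatiOp_re, neg_neg]
  have h4 : (ρ * η * w.re - lam) * -φ.re ≤ |ρ * η * w.re - lam| * x :=
    (mul_le_mul_of_nonneg_right (le_abs_self _) h0).trans
      (mul_le_mul_of_nonneg_left hx (abs_nonneg _))
  have h5 : ρ * η * w.im * φ.im ≤ |ρ * η * w.im| * Y := by
    refine (le_abs_self _).trans ?_
    rw [abs_mul]
    gcongr
  have h6 : η ^ 2 / 2 * φ.im ^ 2 ≤ η ^ 2 / 2 * Y ^ 2 := by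
    rw [← sq_abs φ.im]
    gcongr
  have h8 : 0 ≤ η ^ 2 / 2 * φ.re ^ 2 := by positivity
  linarith

theorem neg_mul_le_sub_mul {c η x N e y : ℝ} (h0 : 0 ≤ x) (hN : x ≤ N) (he : |e| ≤ |y|) :
    -((|c| + η ^ 2 * N) * |y|) ≤ c * e - η ^ 2 * x * e := by
  have h1 : -(|c| * |e|) ≤ c * e := by
    rw [← abs_mul]
    exact neg_abs_le _
  have h2 : |c| * |e| ≤ |c| * |y| := mul_le_mul_of_nonneg_left he (abs_nonneg c)
  have h3 : η ^ 2 * x * e ≤ η ^ 2 * N * |y| :=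
    calc η ^ 2 * x * e ≤ η ^ 2 * x * |y| :=
          mul_le_mul_of_nonneg_left ((le_abs_self e).trans he) (mul_nonneg (sq_nonneg η) h0)
      _ ≤ η ^ 2 * N * |y| := by gcongr
  linarith

/-- Substitute `Im φ = u - e`. Besides non-negative terms, among them `-Re φ` times `η (ρ Im w + η
u)`, only terms linear in `e` are left. This gives the drift estimate for `u - Im ψ`. -/
theorem neg_mul_le_sub_riccatiOp_im {ρ η lam : ℝ} {w φ : ℂ} {N u y : ℝ} (h0 : 0 ≤ -φ.re)
    (hN : -φ.re ≤ N) (hu : 0 ≤ u) (hηu : 0 ≤ η * (ρ * w.im + η * u))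
    (he : |u - φ.im| ≤ |y|) :
    -((|ρ * η * w.re - lam| + η ^ 2 * N) * |y|) ≤ |w.re * w.im - w.im / 2|
      + |ρ * η * w.re - lam| * u - (riccatiOp ρ η lam w φ).im := by
  have h2 := neg_mul_le_sub_mul (c := ρ * η * w.re - lam) (η := η) h0 hN he
  have h3 := mul_nonneg h0 hηu
  have h4 := le_abs_self (w.re * w.im - w.im / 2)
  have h5 := mul_le_mul_of_nonneg_right (le_abs_self (ρ * η * w.re - lam)) hu
  rw [riccatiOp_im]
  linarith

theorem neg_mul_le_add_riccatiOp_im {ρ η lam : ℝ} {w φ : ℂ} {N u y : ℝ} (h0 : 0 ≤ -φ.re)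
    (hN : -φ.re ≤ N) (hu : 0 ≤ u) (hηu : 0 ≤ η * (η * u - ρ * w.im))
    (he : |u + φ.im| ≤ |y|) :
    -((|ρ * η * w.re - lam| + η ^ 2 * N) * |y|) ≤ |w.re * w.im - w.im / 2|
      + |ρ * η * w.re - lam| * u + (riccatiOp ρ η lam w φ).im := by
  have h2 := neg_mul_le_sub_mul (c := ρ * η * w.re - lam) (η := η) h0 hN he
  have h3 := mul_nonneg h0 hηu
  have h4 := neg_abs_le (w.re * w.im - w.im / 2)
  have h5 := mul_le_mul_of_nonneg_right (le_abs_self (ρ * η * w.re - lam)) hu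
  rw [riccatiOp_im]
  linarith

/-- A supersolution which dominates the imaginary part of solutions of the Riccati equation. -/
theorem IsAdmissibleKernel.exists_barrier (hK : IsAdmissibleKernel K γ L) {f : ℝ → ℂ}
    (hf : Measurable f) {C M : ℝ} (hC : ∀ x, ‖f x‖ ≤ C) (hM : ∀ x, M < x → f x = 0)
    {κ₀ d c : ℝ} (hκ₀ : 0 ≤ κ₀) {T : ℝ} (hT : 0 ≤ T) :
    ∃ U u : ℝ → ℝ, ContinuousOn U (Ici 0) ∧ Continuous u ∧
      (∀ t ∈ Icc 0 T, u t = U t + conv (fun s => |d| + |c| * u s) (kernelMeasure K) t) ∧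
      (∀ t ∈ Icc 0 T, κ₀ ≤ u t) ∧
      IsForwardPositive K L (fun t => U t - (forwardCurve K f t).im) ∧
      IsForwardPositive K L (fun t => U t + (forwardCurve K f t).im) ∧
      0 ≤ U 0 - (forwardCurve K f 0).im ∧ 0 ≤ U 0 + (forwardCurve K f 0).im := by
  have hr := hK.isRegularKernel
  have hκ := hr.isLocallyFiniteMeasure
  have hC0 : 0 ≤ C := (norm_nonneg _).trans (hC 0)
  -- Since `e` dominates `|Im f|`, adding or subtracting `Im f` leaves a non-negative function. Its
  -- forward curve, like the constant `κ₀`, satisfies the inequalities of `𝒢_K`.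
  set e : ℝ → ℝ := (Iic M).indicator fun _ => C with he
  have hem : Measurable e := measurable_const.indicator measurableSet_Iic
  have heM : ∀ x, M < x → e x = 0 := fun x hx => indicator_of_notMem (by simpa using hx) _
  have he0 : ∀ x, 0 ≤ e x := fun x => indicator_nonneg (fun _ _ => hC0) x
  have heC : ∀ x, ‖e x‖ ≤ C := fun x => by
    rw [Real.norm_eq_abs, abs_of_nonneg (he0 x)]
    exact indicator_le_self' (fun _ _ => hC0) x
  set y : ℝ → ℝ := fun x => (f x).im with hy
  have hym : Measurable y := Complex.measurable_im.comp hf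
  have hyM : ∀ x, M < x → y x = 0 := fun x hx => by simp [hy, hM x hx]
  have hyC : ∀ x, ‖y x‖ ≤ C := fun x => (Complex.abs_im_le_norm _).trans (hC x)
  have hye : ∀ x, |y x| ≤ e x := fun x => by
    by_cases hx : x ≤ M
    · rw [he, indicator_of_mem (mem_Iic.mpr hx)]
      exact hyC x
    · rw [hyM x (not_le.mp hx), abs_zero]
      exact he0 x
  have hone : ∀ σ : ℝ, |σ| = 1 →
      IsForwardPositive K L (fun t => (κ₀ + forwardCurve K e t) + σ * (forwardCurve K f t).im) ∧
      0 ≤ (κ₀ + forwardCurve K e 0) + σ * (forwardCurve K f 0).im := by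
    intro σ hσ
    set q : ℝ → ℝ := fun x => e x + σ * y x with hq
    have hq0 : ∀ x, 0 ≤ q x := fun x => by
      have h1 : |σ * y x| ≤ e x := by
        rw [abs_mul, hσ, one_mul]
        exact hye x
      have h2 := neg_abs_le (σ * y x)
      simp only [hq]
      linarith
    have hqm : Measurable q := hem.add (hym.const_mul σ)
    have hqM : ∀ x, M < x → q x = 0 := fun x hx => by simp [hq, heM x hx, hyM x hx]
    have hqC : ∀ x, ‖q x‖ ≤ C + C := fun x => by
      refine (norm_add_le _ _).trans (add_le_add (heC x) ?_)
      rw [norm_mul, Real.norm_eq_abs σ, hσ, one_mul]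
      exact hyC x
    have heq : ∀ t, (κ₀ + forwardCurve K e t) + σ * (forwardCurve K f t).im
        = κ₀ + forwardCurve K q t := by
      intro t
      rw [hr.im_forwardCurve hf hC hM, add_assoc]
      congr 1
      simp only [forwardCurve, hq]
      rw [integral_add (hr.integrable_forwardCurve hem heC heM t)
        ((hr.integrable_forwardCurve hym hyC hyM t).const_mul σ), integral_const_mul]
    have hqc := hK.continuousOn_forwardCurve hqm hqC hqM
    refine ⟨?_, ?_⟩
    · simp only [heq]
      exact (IsForwardPositive.const hK.monotone hκ₀).add hK.monotone continuousOn_const hqc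
        (isForwardPositive_forwardCurve hK.monotone hr hqm hqC hqM hq0)
    · rw [heq]
      exact add_nonneg hκ₀ (setIntegral_nonneg measurableSet_Ioi fun x _ => hq0 _)
  have hec := hK.continuousOn_forwardCurve hem heC heM
  have hUc : ContinuousOn (fun t => κ₀ + forwardCurve K e t) (Ici 0) :=
    continuousOn_const.add hec
  have hBc : Continuous fun p : ℝ × ℝ => |d| + |c| * p.2 := by fun_prop
  obtain ⟨u, huc, hu⟩ := exists_volterra_solution (kernelMeasure K) hT (abs_nonneg c)
    (hUc.mono Icc_subset_Ici_self) (B := fun _ x => |d| + |c| * x) hBc (fun t _ x y => by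
      rw [add_sub_add_left_eq_sub, ← mul_sub, norm_mul, Real.norm_eq_abs |c|, abs_abs])
  have he0' : ∀ t, 0 ≤ forwardCurve K e t := fun t =>
    setIntegral_nonneg measurableSet_Ioi fun x _ => he0 _
  have hu0 : ∀ t ∈ Icc 0 T, 0 ≤ u t := by
    refine IsForwardPositive.nonneg hK.monotone hr hUc
      ((IsForwardPositive.const hK.monotone hκ₀).add hK.monotone continuousOn_const hec
        (isForwardPositive_forwardCurve hK.monotone hr hem heC heM he0))
      (add_nonneg hκ₀ (he0' 0)) huc.continuousOn
      (Z := fun s => |d| + |c| * u s) (by fun_prop) hu (abs_nonneg c) fun t _ => ?_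
    have h1 := neg_abs_le (u t)
    have h2 := mul_le_mul_of_nonneg_left h1 (abs_nonneg c)
    have h3 := abs_nonneg d
    linarith
  obtain ⟨h1, h2⟩ := hone (-1) (by simp)
  obtain ⟨h3, h4⟩ := hone 1 (by simp)
  refine ⟨_, u, hUc, huc, hu, fun t ht => ?_, ?_, ?_, ?_, ?_⟩
  · rw [hu t ht]
    have h5 : 0 ≤ vconv (fun s => |d| + |c| * u s) (kernelMeasure K) t :=
      vconv_nonneg fun s hs => add_nonneg (abs_nonneg d)
        (mul_nonneg (abs_nonneg c) (hu0 s ⟨hs.1, hs.2.trans ht.2⟩))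
    have h6 := he0' t
    linarith
  · simpa only [neg_one_mul, ← sub_eq_add_neg] using h1
  · simpa only [one_mul] using h3
  · simpa only [neg_one_mul, ← sub_eq_add_neg] using h2
  · simpa only [one_mul] using h4

/-- The truncated Riccati equation. -/
theorem IsAdmissibleKernel.exists_truncated_solution (hK : IsAdmissibleKernel K γ L)
    (ρ η lam : ℝ) (w : ℂ) {g : ℝ → ℂ} (hg : ContinuousOn g (Ici 0)) {T : ℝ} (hT : 0 ≤ T)
    {N : ℝ} (hN : 0 ≤ N) : ∃ ψ : ℝ → ℂ, Continuous ψ ∧ ∀ t ∈ Icc 0 T,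
      ψ t = g t + vconv (fun s => riccatiOp ρ η lam w (rectProj N (ψ s))) (kernelMeasure K) t := by
  have hκ := hK.isRegularKernel.isLocallyFiniteMeasure
  obtain ⟨ℓ, hℓ, hlip⟩ := exists_riccatiOp_lipschitz ρ η lam w (add_nonneg hN hN)
  have hBc : Continuous fun p : ℝ × ℂ => riccatiOp ρ η lam w (rectProj N p.2) :=
    (continuous_riccatiOp ρ η lam w).comp ((continuous_rectProj N).comp continuous_snd)
  refine exists_volterra_solution (kernelMeasure K) hT (ℓ := ℓ * 2) (by positivity)
    (hg.mono Icc_subset_Ici_self) (B := fun _ x => riccatiOp ρ η lam w (rectProj N x)) hBc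
    fun t _ x y => ?_
  refine (hlip _ _ (norm_rectProj_le hN x) (norm_rectProj_le hN y)).trans ?_
  rw [mul_assoc]
  exact mul_le_mul_of_nonneg_left (norm_rectProj_sub_le N x y) hℓ

/-- Existence for the Riccati-Volterra equation on compact intervals. -/
theorem IsAdmissibleKernel.exists_riccati_on (hK : IsAdmissibleKernel K γ L) {ρ η lam : ℝ}
    (hρ : ρ ∈ Icc (-1 : ℝ) 1) (hη : 0 ≤ η) {w : ℂ} (hw : w.re ∈ Icc (0 : ℝ) 1) {f : ℝ → ℂ}
    (hf : Measurable f) {C M : ℝ} (hC : ∀ x, ‖f x‖ ≤ C) (hM : ∀ x, M < x → f x = 0)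
    (hpos : IsForwardPositive K L fun t => -(forwardCurve K f t).re)
    (h0 : 0 ≤ -(forwardCurve K f 0).re) {T : ℝ} (hT : 0 ≤ T) :
    ∃ ψ : ℝ → ℂ, Continuous ψ ∧ ∀ t ∈ Icc 0 T, (ψ t).re ≤ 0 ∧
      ψ t = forwardCurve K f t
        + vconv (fun s => riccatiOp ρ η lam w (ψ s)) (kernelMeasure K) t := by
  have hr := hK.isRegularKernel
  have hκ := hr.isLocallyFiniteMeasure
  have hgc := hK.continuousOn_complex_forwardCurve hf hC hM
  have hGc : ContinuousOn (fun t => -(forwardCurve K f t).re) (Ici 0) :=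
    (Complex.continuous_re.comp_continuousOn hgc).neg
  have hyc : ContinuousOn (fun t => (forwardCurve K f t).im) (Ici 0) :=
    Complex.continuous_im.comp_continuousOn hgc
  set a := w.re with ha
  set b := w.im with hb
  set c := ρ * η * a - lam with hc
  set d := a * b - b / 2 with hd
  -- The lower bound `u ≥ |b| / η` gives `η u ≥ |ρ b|`. For `η = 0` the quotient is `0` by
  -- convention, which is enough since the conditions in `huη` carry a factor `η`.
  obtain ⟨U, u, hUc, huc, hu, huκ, hD1, hD2, hD10, hD20⟩ := hK.exists_barrier hf hC hM
    (κ₀ := |b| / η) (d := d) (c := c) (div_nonneg (abs_nonneg b) hη) hT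
  have hu0 : ∀ t ∈ Icc 0 T, 0 ≤ u t := fun t ht =>
    (div_nonneg (abs_nonneg b) hη).trans (huκ t ht)
  have huη : ∀ t ∈ Icc 0 T, 0 ≤ η * (ρ * b + η * u t) ∧ 0 ≤ η * (η * u t - ρ * b) := by
    intro t ht
    rcases eq_or_lt_of_le hη with h | h
    · rw [← h]; simp
    · have h1 : |b| ≤ η * u t := by
        have := mul_le_mul_of_nonneg_left (huκ t ht) hη
        rwa [mul_div_cancel₀ _ h.ne'] at this
      have h2 := abs_le.mp ((abs_mul_le_of_mem_Icc hρ b).trans h1)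
      exact ⟨mul_nonneg hη (by linarith [h2.1]), mul_nonneg hη (by linarith [h2.2])⟩
  obtain ⟨U₁, hU₁⟩ := isCompact_Icc.exists_bound_of_continuousOn (s := Icc 0 T) huc.continuousOn
  obtain ⟨S, hS⟩ := isCompact_Icc.exists_bound_of_continuousOn (s := Icc 0 T)
    (hGc.mono Icc_subset_Ici_self)
  have hU₁0 : 0 ≤ U₁ := (norm_nonneg _).trans (hU₁ 0 ⟨le_rfl, hT⟩)
  have hS0 : 0 ≤ S := (norm_nonneg _).trans (hS 0 ⟨le_rfl, hT⟩)
  obtain ⟨D, hD0, hD⟩ := exists_volterra_gronwall (kernelMeasure K) T (abs_nonneg c)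
  set A := (a - a ^ 2 + b ^ 2) / 2 + |ρ * η * b| * U₁ + η ^ 2 / 2 * U₁ ^ 2 with hA
  have haa : 0 ≤ a - a ^ 2 := by nlinarith [hw.1, hw.2]
  have hA0 : 0 ≤ A := by positivity
  set m := (kernelMeasure K).real (Icc 0 T) with hm
  have hm0 : 0 ≤ m := measureReal_nonneg
  -- The two entries are the bounds for `|Im ψ|` and `-Re ψ` proved below; both are fixed before the
  -- truncated solution is chosen.
  set N := max U₁ (D * (S + A * m)) with hN
  have hN0 : 0 ≤ N := hU₁0.trans (le_max_left _ _)
  obtain ⟨ψ, hψc, hψ⟩ := hK.exists_truncated_solution ρ η lam w hgc hT hN0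
  set p : ℝ → ℂ := fun s => rectProj N (ψ s) with hp
  have hpc : Continuous p := (continuous_rectProj N).comp hψc
  have hZc : Continuous fun s => riccatiOp ρ η lam w (p s) :=
    (continuous_riccatiOp ρ η lam w).comp hpc
  have hre : ∀ t ∈ Icc 0 T, -(ψ t).re = -(forwardCurve K f t).re
      + conv (fun s => -(riccatiOp ρ η lam w (p s)).re) (kernelMeasure K) t := by
    intro t ht
    rw [hψ t ht, Complex.add_re, re_vconv hZc.continuousOn, neg_add]
    congr 1
    exact (integral_neg _).symm
  have him : ∀ t ∈ Icc 0 T, (ψ t).im = (forwardCurve K f t).im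
      + conv (fun s => (riccatiOp ρ η lam w (p s)).im) (kernelMeasure K) t := by
    intro t ht
    rw [hψ t ht, Complex.add_im, im_vconv hZc.continuousOn]
  have hZrc : Continuous fun s => -(riccatiOp ρ η lam w (p s)).re :=
    (Complex.continuous_re.comp hZc).neg
  have hZic : Continuous fun s => (riccatiOp ρ η lam w (p s)).im := Complex.continuous_im.comp hZc
  have hχc : Continuous fun s => -(ψ s).re := (Complex.continuous_re.comp hψc).neg
  have hψic : Continuous fun s => (ψ s).im := Complex.continuous_im.comp hψc
  have hp0 : ∀ s, 0 ≤ -(p s).re := fun s => by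
    simp only [hp, rectProj, neg_neg]
    exact le_max_left _ _
  have hpN : ∀ s, -(p s).re ≤ N := fun s => by
    simp only [hp, rectProj, neg_neg]
    exact max_le hN0 (min_le_left _ _)
  have hpabs : ∀ s, -(p s).re ≤ |-(ψ s).re| := fun s => by
    simp only [hp, rectProj, neg_neg]
    exact max_le (abs_nonneg _) ((min_le_right _ _).trans (le_abs_self _))
  -- the real part stays non-positive
  have hχ0 : ∀ t ∈ Icc 0 T, 0 ≤ -(ψ t).re := by
    refine IsForwardPositive.nonneg hK.monotone hr hGc hpos h0 hχc.continuousOn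
      hZrc.continuousOn hre (c := |c| + η ^ 2 / 2 * N) (by positivity) fun t _ => ?_
    exact neg_mul_le_neg_riccatiOp_re hρ η lam hw (hp0 t) (hpN t) (hpabs t)
  -- the imaginary part is dominated by the barrier
  have hclamp : ∀ v, 0 ≤ v → v ≤ N → max (-N) (min N v) = v ∧ max (-N) (min N (-v)) = -v := by
    intro v hv hvN
    rw [min_eq_right hvN, min_eq_right (by linarith), max_eq_right (by linarith),
      max_eq_right (by linarith)]
    exact ⟨rfl, rfl⟩
  have huN : ∀ t ∈ Icc 0 T, u t ≤ N := fun t ht =>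
    (le_abs_self _).trans ((hU₁ t ht).trans (le_max_left _ _))
  have hle1 : ∀ t ∈ Icc 0 T, 0 ≤ u t - (ψ t).im := by
    refine IsForwardPositive.nonneg hK.monotone hr
      (G := fun t => U t - (forwardCurve K f t).im) (hUc.sub hyc) hD1 hD10
      (X := fun t => u t - (ψ t).im) (huc.sub hψic).continuousOn
      (Z := fun s => (|d| + |c| * u s) - (riccatiOp ρ η lam w (p s)).im)
      (Continuous.continuousOn (by fun_prop)) (fun t ht => ?_) (c := |c| + η ^ 2 * N)
      (by positivity) fun t ht => ?_
    · have h1 := vconv_sub (κ := kernelMeasure K) (t := t)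
        (f := fun s => |d| + |c| * u s) (g := fun s => (riccatiOp ρ η lam w (p s)).im)
        (Continuous.continuousOn (by fun_prop)) hZic.continuousOn
      rw [vconv_eq_conv, vconv_eq_conv, vconv_eq_conv] at h1
      rw [h1, hu t ht, him t ht]
      ring
    · have hE : |u t - (p t).im| ≤ |u t - (ψ t).im| := by
        have h1 := abs_clamp_sub_clamp_le (-N) N (u t) (ψ t).im
        rwa [(hclamp _ (hu0 t ht) (huN t ht)).1] at h1
      exact neg_mul_le_sub_riccatiOp_im (hp0 t) (hpN t) (hu0 t ht) (huη t ht).1 hE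
  have hle2 : ∀ t ∈ Icc 0 T, 0 ≤ u t + (ψ t).im := by
    refine IsForwardPositive.nonneg hK.monotone hr
      (G := fun t => U t + (forwardCurve K f t).im) (hUc.add hyc) hD2 hD20
      (X := fun t => u t + (ψ t).im) (huc.add hψic).continuousOn
      (Z := fun s => (|d| + |c| * u s) + (riccatiOp ρ η lam w (p s)).im)
      (Continuous.continuousOn (by fun_prop)) (fun t ht => ?_) (c := |c| + η ^ 2 * N)
      (by positivity) fun t ht => ?_
    · have h1 := vconv_add (κ := kernelMeasure K) (t := t)
        (f := fun s => |d| + |c| * u s) (g := fun s => (riccatiOp ρ η lam w (p s)).im)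
        (Continuous.continuousOn (by fun_prop)) hZic.continuousOn
      rw [vconv_eq_conv, vconv_eq_conv, vconv_eq_conv] at h1
      rw [h1, hu t ht, him t ht]
      ring
    · have hE : |u t + (p t).im| ≤ |u t + (ψ t).im| := by
        have h1 := abs_clamp_sub_clamp_le (-N) N (ψ t).im (-u t)
        rw [(hclamp _ (hu0 t ht) (huN t ht)).2, sub_neg_eq_add, sub_neg_eq_add] at h1
        rwa [add_comm (u t), add_comm (u t)]
      exact neg_mul_le_add_riccatiOp_im (hp0 t) (hpN t) (hu0 t ht) (huη t ht).2 hE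
  have hyU : ∀ t ∈ Icc 0 T, |(ψ t).im| ≤ U₁ := fun t ht => by
    have h1 := (le_abs_self _).trans (hU₁ t ht)
    rw [abs_le]
    constructor <;> linarith [hle1 t ht, hle2 t ht]
  have hpim : ∀ t ∈ Icc 0 T, (p t).im = (ψ t).im := fun t ht => by
    have h1 := abs_le.mp ((hyU t ht).trans (le_max_left U₁ (D * (S + A * m))))
    simp only [hp, rectProj]
    rw [min_eq_right h1.2, max_eq_right h1.1]
  -- the real part is bounded
  have hχle : ∀ t ∈ Icc 0 T, -(ψ t).re ≤ N := by
    intro t ht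
    refine (hD (fun s => -(ψ s).re) (S + A * m) (by positivity) hχc.continuousOn
      (fun r hrT => ?_) t ht).trans (le_max_right _ _)
    have hsub : Icc 0 r ⊆ Icc 0 T := Icc_subset_Icc le_rfl hrT.2
    have h1 : vconv (fun s => -(riccatiOp ρ η lam w (p s)).re) (kernelMeasure K) r
        ≤ vconv (fun s => A + |c| * -(ψ s).re) (kernelMeasure K) r := by
      refine vconv_mono hZrc.continuousOn (Continuous.continuousOn (by fun_prop)) fun s hs => ?_
      have h3 : -(p s).re ≤ -(ψ s).re := by
        have := hpabs s
        rwa [abs_of_nonneg (hχ0 s (hsub hs))] at this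
      exact neg_riccatiOp_re_le ρ η lam (hp0 s) h3 (by
        rw [hpim s (hsub hs)]
        exact hyU s (hsub hs))
    have h2 : vconv (fun s => A + |c| * -(ψ s).re) (kernelMeasure K) r
        = A * (kernelMeasure K).real (Icc 0 r)
          + |c| * vconv (fun s => -(ψ s).re) (kernelMeasure K) r := by
      rw [vconv_add (f := fun _ => A) (g := fun s => |c| * -(ψ s).re) continuousOn_const
        (Continuous.continuousOn (by fun_prop))]
      simp only [vconv, setIntegral_const, integral_const_mul, smul_eq_mul]
      ring
    have h3 : (kernelMeasure K).real (Icc 0 r) ≤ m :=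
      measureReal_mono hsub measure_Icc_lt_top.ne
    have h4 := mul_le_mul_of_nonneg_left h3 hA0
    have h5 := (le_abs_self _).trans (hS r hrT)
    have h6 := hre r hrT
    rw [← vconv_eq_conv] at h6
    linarith
  have hpψ : ∀ t ∈ Icc 0 T, p t = ψ t := fun t ht => by
    refine Complex.ext ?_ (hpim t ht)
    simp only [hp, rectProj]
    rw [min_eq_right (hχle t ht), max_eq_right (hχ0 t ht), neg_neg]
  refine ⟨ψ, hψc, fun t ht => ⟨by linarith [hχ0 t ht], ?_⟩⟩
  conv_lhs => rw [hψ t ht]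
  congr 1
  refine vconv_congr fun s hs => ?_
  change riccatiOp ρ η lam w (p s) = _
  rw [hpψ s ⟨hs.1, hs.2.trans ht.2⟩]

/-- On a common bound for the two solutions `ℛ` is Lipschitz, so Gronwall applies with `a = 0`. -/
theorem IsRegularKernel.riccati_unique (hr : IsRegularKernel K) {ρ η lam : ℝ} {w : ℂ}
    {g ψ ψ' : ℝ → ℂ} {T : ℝ} (hψc : ContinuousOn ψ (Icc 0 T)) (hψc' : ContinuousOn ψ' (Icc 0 T))
    (hψ : ∀ t ∈ Icc 0 T, ψ t = g t
      + vconv (fun s => riccatiOp ρ η lam w (ψ s)) (kernelMeasure K) t)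
    (hψ' : ∀ t ∈ Icc 0 T, ψ' t = g t
      + vconv (fun s => riccatiOp ρ η lam w (ψ' s)) (kernelMeasure K) t) :
    ∀ t ∈ Icc 0 T, ψ t = ψ' t := by
  have hκ := hr.isLocallyFiniteMeasure
  obtain ⟨C, hC⟩ := isCompact_Icc.exists_bound_of_continuousOn hψc
  obtain ⟨C', hC'⟩ := isCompact_Icc.exists_bound_of_continuousOn hψc'
  obtain ⟨ℓ, hℓ, hlip⟩ := exists_riccatiOp_lipschitz ρ η lam w (M := max 0 (max C C'))
    (le_max_left _ _)
  obtain ⟨D, -, hD⟩ := exists_volterra_gronwall (kernelMeasure K) T hℓ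
  intro t ht
  have h := hD (fun s => ‖ψ s - ψ' s‖) 0 le_rfl (hψc.sub hψc').norm (fun r hrT => by
    have hsub : Icc 0 r ⊆ Icc 0 T := Icc_subset_Icc le_rfl hrT.2
    have hRc : ∀ φ : ℝ → ℂ, ContinuousOn φ (Icc 0 T) →
        ContinuousOn (fun s => riccatiOp ρ η lam w (φ s)) (Icc 0 r) := fun φ hφ =>
      (continuous_riccatiOp ρ η lam w).comp_continuousOn (hφ.mono hsub)
    have h1 : ψ r - ψ' r = vconv (fun s => riccatiOp ρ η lam w (ψ s)
        - riccatiOp ρ η lam w (ψ' s)) (kernelMeasure K) r := by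
      rw [vconv_sub (hRc _ hψc) (hRc _ hψc'), hψ r hrT, hψ' r hrT, add_sub_add_left_eq_sub]
    have hnc := ((hψc.sub hψc').norm).mono hsub
    calc ‖ψ r - ψ' r‖ ≤ vconv (fun s => ‖riccatiOp ρ η lam w (ψ s)
          - riccatiOp ρ η lam w (ψ' s)‖) (kernelMeasure K) r := by
          rw [h1]
          exact norm_vconv_le
      _ ≤ vconv (fun s => ℓ * ‖ψ s - ψ' s‖) (kernelMeasure K) r := by
          refine vconv_mono ((hRc _ hψc).sub (hRc _ hψc')).norm (continuousOn_const.mul hnc)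
            fun s hs => hlip _ _ ?_ ?_
          · exact (hC s (hsub hs)).trans ((le_max_left _ _).trans (le_max_right _ _))
          · exact (hC' s (hsub hs)).trans ((le_max_right _ _).trans (le_max_right _ _))
      _ = 0 + ℓ * vconv (fun s => ‖ψ s - ψ' s‖) (kernelMeasure K) r := by
          rw [zero_add]
          exact integral_const_mul _ _) t ht
  rw [mul_zero] at h
  exact sub_eq_zero.mp (norm_le_zero_iff.mp h)

/-- Global existence for the Riccati-Volterra equation. -/
theorem IsAdmissibleKernel.exists_riccati (hK : IsAdmissibleKernel K γ L) {ρ η lam : ℝ}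
    (hρ : ρ ∈ Icc (-1 : ℝ) 1) (hη : 0 ≤ η) {w : ℂ} (hw : w.re ∈ Icc (0 : ℝ) 1) {f : ℝ → ℂ}
    (hf : Measurable f) {C M : ℝ} (hC : ∀ x, ‖f x‖ ≤ C) (hM : ∀ x, M < x → f x = 0)
    (hpos : IsForwardPositive K L fun t => -(forwardCurve K f t).re)
    (h0 : 0 ≤ -(forwardCurve K f 0).re) :
    ∃ ψ : ℝ → ℂ, ContinuousOn ψ (Ici 0) ∧ ∀ t, 0 ≤ t → (ψ t).re ≤ 0 ∧
      ψ t = forwardCurve K f t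
        + vconv (fun s => riccatiOp ρ η lam w (ψ s)) (kernelMeasure K) t := by
  have hr := hK.isRegularKernel
  choose φ hφc hφ using fun n : ℕ => hK.exists_riccati_on hρ hη (lam := lam) hw hf hC hM hpos h0
    (Nat.cast_nonneg (α := ℝ) n)
  have hagree : ∀ m n : ℕ, m ≤ n → ∀ t ∈ Icc (0 : ℝ) m, φ m t = φ n t := by
    intro m n hmn
    have hmn' : (m : ℝ) ≤ n := Nat.cast_le.mpr hmn
    exact hr.riccati_unique (hφc m).continuousOn (hφc n).continuousOn
      (fun t ht => (hφ m t ht).2) fun t ht => (hφ n t ⟨ht.1, ht.2.trans hmn'⟩).2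
  set ψ : ℝ → ℂ := fun t => φ ⌈t⌉₊ t with hψ
  have hψn : ∀ n : ℕ, ∀ t ∈ Icc (0 : ℝ) n, ψ t = φ n t := fun n t ht =>
    hagree _ n (Nat.ceil_le.mpr ht.2) t ⟨ht.1, Nat.le_ceil t⟩
  refine ⟨ψ, fun t ht => ?_, fun t ht => ?_⟩
  -- The extra `1` is needed because points just to the right of `t` may exceed `⌈t⌉₊`.
  · have hev : ψ =ᶠ[𝓝[Ici 0] t] φ (⌈t⌉₊ + 1) := by
      filter_upwards [self_mem_nhdsWithin,
        mem_nhdsWithin_of_mem_nhds (Iio_mem_nhds (by linarith : t < t + 1))] with x hx hx'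
      refine hψn _ x ⟨hx, ?_⟩
      push_cast
      linarith [Nat.le_ceil t, mem_Iio.mp hx']
    refine (hφc _).continuousWithinAt.congr_of_eventuallyEq hev (hψn _ t ⟨ht, ?_⟩)
    push_cast
    linarith [Nat.le_ceil t]
  · have htn : t ∈ Icc (0 : ℝ) (⌈t⌉₊ : ℕ) := ⟨ht, Nat.le_ceil t⟩
    obtain ⟨h1, h2⟩ := hφ _ t htn
    refine ⟨h1, ?_⟩
    change φ ⌈t⌉₊ t = _
    conv_lhs => rw [h2]
    congr 1
    refine vconv_congr fun s hs => ?_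
    rw [hψn _ s ⟨hs.1, hs.2.trans htn.2⟩]

end Riccati

/-! ### From the scalar solution to the Riccati equation in two variables. -/

section Solution

variable {K : ℝ → ℝ} {L : Measure ℝ} {γ : ℝ}

theorem IsBoundedCompactlySupported.exists_extension {h : ℝ → ℂ}
    (hh : IsBoundedCompactlySupported h) : ∃ (f : ℝ → ℂ) (C M : ℝ), Measurable f ∧
      (∀ x, ‖f x‖ ≤ C) ∧ (∀ x, M < x → f x = 0) ∧ ∀ x, 0 ≤ x → f x = h x := by
  obtain ⟨hm, ⟨C, hC⟩, M, hM⟩ := hh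
  refine ⟨fun x => h (x.toNNReal : ℝ), C, max M 0, hm.comp measurable_real_toNNReal,
    fun x => hC _ (NNReal.coe_nonneg _), fun x hx => ?_, fun x hx => ?_⟩
  · have hx0 : 0 < x := (le_max_right _ _).trans_lt hx
    simp only [Real.coe_toNNReal x hx0.le]
    exact hM x hx0.le ((le_max_left _ _).trans_lt hx)
  · simp only [Real.coe_toNNReal x hx]

/-- The function `ξ ↦ f(ξ - t) 1_{ξ ≥ t} + r(t - ξ) 1_{ξ < t}`. -/
noncomputable def spliceAt (f r : ℝ → ℂ) (t ξ : ℝ) : ℂ := if t ≤ ξ then f (ξ - t) else r (t - ξ)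

theorem measurable_spliceAt {f r : ℝ → ℂ} (hf : Measurable f) (hr : Measurable r) (t : ℝ) :
    Measurable (spliceAt f r t) :=
  Measurable.ite measurableSet_Ici (hf.comp (by fun_prop)) (hr.comp (by fun_prop))

/-- The forward curve of a spliced function. -/
theorem IsRegularKernel.forwardCurve_spliceAt (hK : IsRegularKernel K) {f r : ℝ → ℂ}
    (hf : Measurable f) (hr : Continuous r) {C M : ℝ} (hC : ∀ x, ‖f x‖ ≤ C)
    (hM : ∀ x, M < x → f x = 0) {t s : ℝ} (ht : 0 ≤ t) (hs : 0 ≤ s) :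
    forwardCurve K (spliceAt f r t) s
      = forwardCurve K f (t + s) + vconv ((Iio t).indicator r) (kernelMeasure K) (t + s) := by
  have hκ := hK.isLocallyFiniteMeasure
  have h1 : ∀ x ∈ Ioi (t + s), spliceAt f r t (x - s) = f (x - (t + s)) := fun x hx => by
    have hx := mem_Ioi.mp hx
    rw [spliceAt, if_pos (by linarith)]
    congr 1
    ring
  have h2 : ∀ᵐ x ∂(kernelMeasure K), x ∈ Ioc s (t + s) →
      spliceAt f r t (x - s) = r (t + s - x) := by
    filter_upwards [measure_eq_zero_iff_ae_notMem.mp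
      (NullSingletonClass.measure_singleton (μ := kernelMeasure K) (t + s))] with x hx hx'
    have hxt : x < t + s := lt_of_le_of_ne hx'.2 hx
    rw [spliceAt, if_neg (by linarith)]
    congr 1
    ring
  have hI1 : IntegrableOn (fun x => spliceAt f r t (x - s)) (Ioi (t + s)) (kernelMeasure K) :=
    (integrableOn_congr_fun h1 measurableSet_Ioi).mpr
      (hK.integrable_forwardCurve hf hC hM (t + s))
  have hI2 : IntegrableOn (fun x => spliceAt f r t (x - s)) (Ioc s (t + s))
      (kernelMeasure K) := by
    have h3 : IntegrableOn (fun x => r (t + s - x)) (Icc s (t + s)) (kernelMeasure K) :=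
      ContinuousOn.integrableOn_compact isCompact_Icc
        (hr.comp (continuous_const.sub continuous_id)).continuousOn
    refine (h3.mono_set Ioc_subset_Icc_self).congr ?_
    rw [EventuallyEq, ae_restrict_iff' measurableSet_Ioc]
    exact h2.mono fun x hx hx' => (hx hx').symm
  have hunion : Ioc s (t + s) ∪ Ioi (t + s) = Ioi s := Ioc_union_Ioi_eq_Ioi (by linarith)
  have hdisj : Disjoint (Ioc s (t + s)) (Ioi (t + s)) :=
    disjoint_left.mpr fun x hx hx' => not_lt.mpr hx.2 (mem_Ioi.mp hx')
  have h4 : vconv ((Iio t).indicator r) (kernelMeasure K) (t + s)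
      = ∫ x in Icc 0 (t + s), (Ioi s).indicator (fun x => r (t + s - x)) x
        ∂(kernelMeasure K) := by
    refine setIntegral_congr_fun measurableSet_Icc fun x _ => ?_
    by_cases hx : s < x
    · rw [indicator_of_mem (mem_Ioi.mpr hx), indicator_of_mem (mem_Iio.mpr (by linarith))]
    · rw [indicator_of_notMem (fun hc => hx (mem_Ioi.mp hc)), indicator_of_notMem (fun hc =>
        hx (by linarith [mem_Iio.mp hc]))]
  have h5 : Icc 0 (t + s) ∩ Ioi s = Ioc s (t + s) := by
    ext x
    simp only [mem_inter_iff, mem_Icc, mem_Ioi, mem_Ioc]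
    exact ⟨fun h => ⟨h.2, h.1.2⟩, fun h => ⟨⟨by linarith [h.1], h.2⟩, h.1⟩⟩
  rw [forwardCurve, ← hunion, setIntegral_union hdisj measurableSet_Ioi hI2 hI1, add_comm,
    setIntegral_congr_fun measurableSet_Ioi h1, setIntegral_congr_ae measurableSet_Ioc h2, h4,
    setIntegral_indicator measurableSet_Ioi, h5]
  rfl

/-- The cut-off matters only at `x = 0` when `u = t`, a null point for the kernel measure. -/
theorem vconv_indicator_Iio {r : ℝ → ℂ} {t u : ℝ} (hut : u ≤ t) :
    vconv ((Iio t).indicator r) (kernelMeasure K) u = vconv r (kernelMeasure K) u := by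
  refine setIntegral_congr_ae measurableSet_Icc ?_
  filter_upwards [measure_eq_zero_iff_ae_notMem.mp
    (NullSingletonClass.measure_singleton (μ := kernelMeasure K) (0 : ℝ))] with x hx hx'
  have hx0 : 0 < x := lt_of_le_of_ne hx'.1 (Ne.symm hx)
  rw [indicator_of_mem (mem_Iio.mpr (by linarith))]

theorem mem_GSet_congr {g g' : ℝ → ℝ} (h : ∀ t, 0 ≤ t → g t = g' t) (hg : g ∈ GSet γ K L) :
    g' ∈ GSet γ K L := by
  obtain ⟨h1, h2, h3⟩ := hg
  refine ⟨fun r hr T => ?_, by rwa [← h 0 le_rfl], fun ξ hξ t ht => ?_⟩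
  · obtain ⟨C, hC⟩ := h1 r hr T
    refine ⟨C, fun x hx y hy => ?_⟩
    rw [← h x hx.1, ← h y hy.1]
    exact hC x hx y hy
  · have h4 := h3 ξ hξ t ht
    have h5 : conv g (stieltjesMeasure (conv (shift ξ K) L)) t
        = conv g' (stieltjesMeasure (conv (shift ξ K) L)) t :=
      vconv_congr fun s hs => h s hs.1
    rw [h5] at h4
    simp only [shift] at *
    rwa [h _ (by linarith), h t ht] at h4

/-- The forward curve of the spliced function is the solution curve continued beyond `t` with its
drift switched off. Non-negativity of `-Re` up to `t` is thus what the persistence of the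
inequalities needs; Hölder continuity holds for every bounded, compactly supported function. -/
theorem spliceAt_mem_GStarSet (hK : IsAdmissibleKernel K γ L) {f r : ℝ → ℂ}
    (hf : Measurable f) (hrc : Continuous r) {C M : ℝ} (hC : ∀ x, ‖f x‖ ≤ C)
    (hM : ∀ x, M < x → f x = 0)
    (hpos : IsForwardPositive K L fun t => -(forwardCurve K f t).re) {t : ℝ} (ht : 0 ≤ t)
    (hre : ∀ u ∈ Icc 0 t, (forwardCurve K f u + vconv r (kernelMeasure K) u).re ≤ 0) :
    spliceAt f r t ∈ GStarSet γ K L := by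
  have hr := hK.isRegularKernel
  have hκ := hr.isLocallyFiniteMeasure
  -- Only the values of `r` on `[0, t]` enter for `ξ ≥ 0`; freezing it outside makes it bounded on
  -- the whole line.
  set r' : ℝ → ℂ := fun u => r (max 0 (min u t)) with hr'
  have hr'c : Continuous r' := hrc.comp (by fun_prop)
  obtain ⟨D, hD⟩ := isCompact_Icc.exists_bound_of_continuousOn (s := Icc 0 t) hrc.continuousOn
  have hr'D : ∀ u, ‖r' u‖ ≤ D := fun u =>
    hD _ ⟨le_max_left _ _, max_le ht (min_le_right _ _)⟩
  have hr'eq : ∀ u ∈ Icc 0 t, r' u = r u := fun u hu => by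
    simp only [hr']
    rw [min_eq_left hu.2, max_eq_right hu.1]
  have hsplice : ∀ ξ, 0 ≤ ξ → spliceAt f r t ξ = spliceAt f r' t ξ := fun ξ hξ => by
    unfold spliceAt
    split_ifs with h
    · rfl
    · rw [hr'eq _ ⟨by linarith, by linarith⟩]
  have hsm := measurable_spliceAt hf hr'c.measurable t
  have hb : ∀ x, ‖spliceAt f r' t x‖ ≤ max C D := fun x => by
    unfold spliceAt
    split_ifs
    · exact (hC _).trans (le_max_left _ _)
    · exact (hr'D _).trans (le_max_right _ _)
  have hz : ∀ x, max M 0 + t < x → spliceAt f r' t x = 0 := fun x hx => by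
    have h1 := le_max_left M 0
    have h2 := le_max_right M 0
    rw [spliceAt, if_pos (by linarith), hM _ (by linarith)]
  refine ⟨⟨?_, ⟨max C D, fun x hx => by rw [hsplice x hx]; exact hb x⟩,
    max M 0 + t, fun x hx hxM => by rw [hsplice x hx]; exact hz x hxM⟩, ?_⟩
  · have h1 : (fun x : ℝ≥0 => spliceAt f r t x) = fun x : ℝ≥0 => spliceAt f r' t x :=
      funext fun x => hsplice x x.coe_nonneg
    rw [h1]
    exact hsm.comp measurable_subtype_coe
  set Z : ℝ → ℝ := fun u => -((Iio t).indicator r' u).re with hZ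
  have hindm : Measurable ((Iio t).indicator r') := hr'c.measurable.indicator measurableSet_Iio
  have hindD : ∀ u, ‖(Iio t).indicator r' u‖ ≤ D := fun u =>
    (norm_indicator_le_norm_self r' u).trans (hr'D u)
  have hZm : Measurable Z := (Complex.measurable_re.comp hindm).neg
  have hZD : ∀ u, ‖Z u‖ ≤ D := fun u => by
    rw [norm_neg]
    exact (Complex.abs_re_le_norm _).trans (hindD u)
  have hZt : ∀ u, t ≤ u → Z u = 0 := fun u hu => by
    simp only [hZ]
    rw [indicator_of_notMem (by simpa using hu), Complex.zero_re, neg_zero]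
  have hre_conv : ∀ u, -(vconv ((Iio t).indicator r') (kernelMeasure K) u).re
      = conv Z (kernelMeasure K) u := by
    intro u
    have h1 : IntegrableOn (fun s => (Iio t).indicator r' (u - s)) (Icc 0 u) (kernelMeasure K) :=
      Measure.integrableOn_of_bounded measure_Icc_lt_top.ne
        (hindm.comp (by fun_prop)).aestronglyMeasurable (Eventually.of_forall fun s => hindD _)
    have h2 : (vconv ((Iio t).indicator r') (kernelMeasure K) u).re
        = ∫ s in Icc 0 u, ((Iio t).indicator r' (u - s)).re ∂(kernelMeasure K) :=
      (Complex.reCLM.integral_comp_comm h1).symm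
    rw [h2]
    exact (integral_neg _).symm
  have hGc := (hK.memHolderBelow_neg_re_forwardCurve hf hC hM).continuousOn
    (by linarith [hK.gamma_mem.1])
  have hX : ∀ s, 0 ≤ s → -(forwardCurve K (spliceAt f r' t) s).re
      = -(forwardCurve K f (t + s)).re + conv Z (kernelMeasure K) (t + s) := by
    intro s hs
    rw [hr.forwardCurve_spliceAt hf hr'c hC hM ht hs, Complex.add_re, neg_add,
      hre_conv]
  have hXpos : ∀ u ∈ Icc 0 t, 0 ≤ -(forwardCurve K f u).re + conv Z (kernelMeasure K) u := by
    intro u hu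
    have h1 : vconv r (kernelMeasure K) u = vconv r' (kernelMeasure K) u :=
      vconv_congr fun s hs => (hr'eq s ⟨hs.1, hs.2.trans hu.2⟩).symm
    have h2 := hre u hu
    rw [← hre_conv, vconv_indicator_Iio hu.2, ← h1]
    rw [Complex.add_re] at h2
    linarith
  have hfwd : (fun s => -(forwardCurve K (spliceAt f r' t) s).re) ∈ GSet γ K L := by
    refine ⟨hK.memHolderBelow_neg_re_forwardCurve hsm hb hz, ?_, ?_⟩
    · have h1 := hX 0 le_rfl
      rw [add_zero] at h1
      change 0 ≤ -(forwardCurve K (spliceAt f r' t) 0).re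
      rw [h1]
      exact hXpos t ⟨ht, le_rfl⟩
    · intro δ hδ s hs
      have h1 := hpos.shift_add_conv hK.monotone hr hGc hZm hZD ht hZt hXpos δ hδ s hs
      have h2 : conv (fun s => -(forwardCurve K (spliceAt f r' t) s).re)
          (stieltjesMeasure (conv (shift δ K) L)) s
          = conv (fun s => -(forwardCurve K f (t + s)).re + conv Z (kernelMeasure K) (t + s))
            (stieltjesMeasure (conv (shift δ K) L)) s :=
        vconv_congr fun u hu => hX u hu.1
      rw [h2]
      simp only [shift] at *
      rw [hX s hs, hX (s + δ) (by linarith)]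
      exact h1
  refine mem_GSet_congr (fun s hs => ?_) hfwd
  rw [hr.integral_mul_kernel _ hs, forwardCurve_congr hsplice]

end Solution

end VolterraHeston

theorem mainTheorem8 (ρ η lam : ℝ) (hρ : ρ ∈ Set.Icc (-1 : ℝ) 1) (hη : 0 ≤ η) (hlam : 0 ≤ lam)
    (K : ℝ → ℝ) (γ : ℝ) (L : MeasureTheory.Measure ℝ)
    (hK : VolterraHeston.IsAdmissibleKernel K γ L)
    (hshift : ∀ ξ : ℝ, 0 ≤ ξ → ∃ L' : MeasureTheory.Measure ℝ,
      VolterraHeston.MonotoneCondition (VolterraHeston.shift ξ K) L')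
    (w : ℂ) (hw : w.re ∈ Set.Icc (0 : ℝ) 1)
    (h : ℝ → ℂ) (hh : h ∈ VolterraHeston.GStarSet γ K L) :
    ∃ Ψ : ℝ → ℝ → ℂ, VolterraHeston.IsRiccatiSolution ρ η lam K w h Ψ ∧
      ∀ t : ℝ, 0 ≤ t → Ψ t ∈ VolterraHeston.GStarSet γ K L := by
  open VolterraHeston in
  have hr := hK.isRegularKernel
  obtain ⟨f, C, M, hf, hC, hM, hfh⟩ := hh.1.exists_extension
  have hG : (fun t => -(forwardCurve K f t).re) ∈ GSet γ K L :=
    mem_GSet_congr (fun t ht => by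
      rw [hr.integral_mul_kernel h ht, forwardCurve_congr hfh]) hh.2
  obtain ⟨ψ, hψc, hψ⟩ := hK.exists_riccati hρ hη (lam := lam) hw hf hC hM hG.2.2 hG.2.1
  set r : ℝ → ℂ := fun u => riccatiOp ρ η lam w (ψ (max u 0)) with hr_def
  have hrc : Continuous r := by
    refine (continuous_riccatiOp ρ η lam w).comp ?_
    rw [← continuousOn_univ]
    exact hψc.comp (by fun_prop) fun x _ => Set.mem_Ici.mpr (le_max_right _ _)
  have hψr : ∀ t, 0 ≤ t → ψ t = forwardCurve K f t + vconv r (kernelMeasure K) t := by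
    intro t ht
    rw [(hψ t ht).2]
    congr 1
    refine vconv_congr fun s hs => ?_
    simp only [hr_def, max_eq_left hs.1]
  have hmem : ∀ t, 0 ≤ t → spliceAt f r t ∈ GStarSet γ K L := fun t ht =>
    spliceAt_mem_GStarSet hK hf hrc hC hM hG.2.2 ht fun u hu => by
      rw [← hψr u hu.1]
      exact (hψ u hu.1).1
  refine ⟨spliceAt f r, fun t ξ ht hξ => ?_, hmem⟩
  rw [spliceAt]
  by_cases htξ : t ≤ ξ
  · rw [if_pos htξ, if_pos htξ, hfh _ (sub_nonneg.mpr htξ)]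
  · rw [if_neg htξ, if_neg htξ]
    have hu : 0 ≤ t - ξ := by linarith
    -- Consistency of the construction: the forward curve at `0` of the spliced function is the
    -- right side of the Volterra equation at time `t - ξ`.
    have h1 : ∫ z in Set.Ioi (0 : ℝ), spliceAt f r (t - ξ) z * (K z : ℂ) = ψ (t - ξ) := by
      have h2 := hr.integral_mul_kernel (spliceAt f r (t - ξ)) le_rfl
      simp only [zero_add] at h2
      rw [h2, hr.forwardCurve_spliceAt hf hrc hC hM hu le_rfl, add_zero,
        vconv_indicator_Iio le_rfl, ← hψr _ hu]
    rw [h1]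
    simp only [hr_def, max_eq_left hu]
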